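/- Let $\varphi$ be the Laplace transform of a probability measure $\rho$ on $[0,\infty)$, extended to complex arguments by $\varphi(z)=\int_{[0,\infty)}e^{-zu}\,\rho(du)$ for $\operatorname{Re}z\ge 0$. A characteristic function (ChF) is the function $t\mapsto\int_{\mathbb R} e^{itx}\,\mu(dx)$ of a probability measure $\mu$ on $\mathbb R$. A ChF $\omega$ is called stable if for every integer $n\ge 1$ there are $c>0$ and $d\in\mathbb R$ with $\omega(t)^n=e^{idt}\omega(ct)$ for all $t\in\mathbb R$ (ChFs of point masses are included). A ChF $f$ is called $\varphi$-stable if there is a continuous function $\psi:\mathbb R\to\mathbb C$ with $\psi(0)=0$ such that $e^{-\psi}$ is a stable ChF and $f(t)=\varphi(\psi(t))$ for all $t\in\mathbb R$. The domain of $\varphi$-attraction of a ChF $f$ is the set of all ChFs $g$ for which there are real sequences $a_n>0$ and $b_n$ such that, for every $t\in\mathbb R$, $$\varphi\bigl\{n\bigl(1-g(t/a_n)e^{-itb_n}\bigr)\bigr\}\longrightarrow f(t)\qquad(n\to\infty).$$ **Theorem 4.1.** A ChF $f$ has a nonempty domain of $\varphi$-attraction if and only if $f$ is $\varphi$-stable.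 -/

import Mathlib

open MeasureTheory Filter Topology

/-- `f : ℝ → ℂ` is a characteristic function: `f t = ∫ exp (i t x) dμ(x)` for a probability
measure `μ` on the real line. -/
def IsCharFun (f : ℝ → ℂ) : Prop :=
  ∃ μ : Measure ℝ, IsProbabilityMeasure μ ∧ ∀ t : ℝ, f t = charFun μ t

/-- `φ` is the Laplace transform of a probability measure on `[0, ∞)`, considered on the closed
right half-plane, where the integral converges absolutely. (Characteristic functions are
inserted into `φ`, so complex arguments are needed; the values of `φ` outside this half-plane are
irrelevant.) -/
def IsLaplaceTransform (φ : ℂ → ℂ) : Prop :=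
  ∃ ρ : Measure ℝ, IsProbabilityMeasure ρ ∧ ρ (Set.Iio 0) = 0 ∧
    ∀ z : ℂ, 0 ≤ z.re → φ z = ∫ u : ℝ, Complex.exp (-(z * (u : ℂ))) ∂ρ

/-- `ω` is a stable characteristic function (in the wide sense; point masses are included): for
every `n ≥ 1` the sum of `n` independent copies has the law of `c X + d`, for some
`c > 0` and `d ∈ ℝ`. -/
def IsStableCharFun (ω : ℝ → ℂ) : Prop :=
  IsCharFun ω ∧ ∀ n : ℕ, 1 ≤ n → ∃ c : ℝ, 0 < c ∧ ∃ d : ℝ, ∀ t : ℝ,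
    ω t ^ n = Complex.exp (Complex.I * (d : ℂ) * (t : ℂ)) * ω (c * t)

/-- `f` is `φ`-stable: `f = φ (-log ω)` with `ω` a stable characteristic function. Here
`ψ = -log ω` is the distinguished (continuous, vanishing at `0`) logarithm. -/
def IsPhiStable (φ : ℂ → ℂ) (f : ℝ → ℂ) : Prop :=
  ∃ ψ : ℝ → ℂ, Continuous ψ ∧ ψ 0 = 0 ∧ IsStableCharFun (fun t => Complex.exp (-ψ t)) ∧
    ∀ t : ℝ, f t = φ (ψ t)

/-- The domain of `φ`-attraction of `f`: all characteristic functions `g` such that, for some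
real constants `a n > 0` and `b n`, and with `gₙ t = g (t / a n) * exp (-i t (b n))`, one has
`φ (n * (1 - gₙ t)) → f t` for all real `t`. -/
def phiAttractionDomain (φ : ℂ → ℂ) (f : ℝ → ℂ) : Set (ℝ → ℂ) :=
  {g | IsCharFun g ∧ ∃ a b : ℕ → ℝ, (∀ n, 0 < a n) ∧ ∀ t : ℝ,
    Tendsto (fun n : ℕ => φ ((n : ℂ) *
      (1 - g (t / a n) * Complex.exp (-(Complex.I * (t : ℂ) * (b n : ℂ))))))
      atTop (𝓝 (f t))}

/-! Write ψ_n(t) = n(1 - g_n(t)). These are exponents of compound Poisson laws, so φ(ψ_n) is the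
characteristic function of a law subordinated by ρ. The task is to pass from convergence of φ(ψ_n)
to convergence of ψ_n, although φ need not be injective on the half-plane.

Compactness: convergence of φ(ψ_n) to a characteristic function gives equicontinuity at 0. It passes
to ψ_n because φ omits the value 1 near 0 except at 0 (`equicontinuousAt_of_laplace`).
Near-additivity of exponents spreads it over the line, so limits exist along every ultrafilter. A
linear limit iβt already gives f(t) = φ(iβt), a degenerate φ-stable function.

Otherwise all limits are nondegenerate. Convergence of types relates limits along n and n + 1 by
Ψ'(t) = Ψ(ct) + idt, while φ(Ψ) = φ(Ψ') = f. Rigidity (`affine_trivial_of_laplace_eq`) forces Ψ' =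
Ψ: after reduction to c ≤ 1 and nonnegative drift, a nontrivial affine map would push the paths
upwards unless they are nonnegative, and for nonnegative paths strict monotonicity of φ on [0, ∞)
forces degeneracy. Hence ψ_{n+1} - ψ_n → 0. Where Re Ψ > 0 the level sets of the analytic φ are
discrete, so slow variation turns a cluster point into a limit; such t are dense. Comparing n with
mn then shows that the limit is stable.

Conversely, a stable ω = exp(-ψ) attracts itself: its normalizations are exactly exp(-ψ/n), and n(1
- exp(-ψ/n)) → ψ. -/

namespace IsCharFun

/-! ### Characteristic functions: closure properties, tightness, near-additivity. -/

lemma zero {f : ℝ → ℂ} (hf : IsCharFun f) : f 0 = 1 := by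
  obtain ⟨μ, hμ, h⟩ := hf
  rw [h, charFun_zero]; simp

lemma norm_le_one {f : ℝ → ℂ} (hf : IsCharFun f) (t : ℝ) : ‖f t‖ ≤ 1 := by
  obtain ⟨μ, hμ, h⟩ := hf
  rw [h]; exact norm_charFun_le_one t

lemma continuous {f : ℝ → ℂ} (hf : IsCharFun f) : Continuous f := by
  obtain ⟨μ, hμ, h⟩ := hf
  rw [funext h]
  exact continuous_charFun

lemma neg_eq_conj {f : ℝ → ℂ} (hf : IsCharFun f) (t : ℝ) : f (-t) = (starRingEnd ℂ) (f t) := by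
  obtain ⟨μ, hμ, h⟩ := hf
  rw [h, h, charFun_neg]

lemma exp_linear (b : ℝ) : IsCharFun (fun t => Complex.exp (Complex.I * b * t)) := by
  refine ⟨Measure.dirac b, inferInstance, fun t => ?_⟩
  rw [charFun_dirac]
  simp
  ring_nf

lemma one : IsCharFun (fun _ => 1) := by simpa using exp_linear 0

lemma mul {f g : ℝ → ℂ} (hf : IsCharFun f) (hg : IsCharFun g) : IsCharFun (fun t => f t * g t) := by
  obtain ⟨μ, hμ, h⟩ := hf
  obtain ⟨ν, hν, h'⟩ := hg
  exact ⟨μ ∗ ν, inferInstance, fun t => by simp only [charFun_conv, h, h']⟩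

lemma pow {f : ℝ → ℂ} (hf : IsCharFun f) (n : ℕ) : IsCharFun (fun t => f t ^ n) := by
  induction n with
  | zero => simpa using one
  | succ n ih => simpa [pow_succ] using ih.mul hf

lemma comp_mul {f : ℝ → ℂ} (hf : IsCharFun f) (c : ℝ) : IsCharFun (fun t => f (c * t)) := by
  obtain ⟨μ, hμ, h⟩ := hf
  refine ⟨μ.map (c * ·), Measure.isProbabilityMeasure_map (by fun_prop), fun t => ?_⟩
  simp only [charFun_map_mul, h]

/-- Transform of the mixture (1 - p)δ₀ + pμ; its powers approximate compound Poisson laws. -/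
lemma convex_one {f : ℝ → ℂ} (hf : IsCharFun f) {p : ℝ} (h0 : 0 ≤ p) (h1 : p ≤ 1) :
    IsCharFun (fun t => 1 - p * (1 - f t)) := by
  obtain ⟨μ, hμ, h⟩ := hf
  refine ⟨ENNReal.ofReal (1 - p) • Measure.dirac 0 + ENNReal.ofReal p • μ, ⟨?_⟩, fun t => ?_⟩
  · simp [← ENNReal.ofReal_add (sub_nonneg.2 h1) h0]
  · have hi : ∀ ν : Measure ℝ, IsFiniteMeasure ν →
        Integrable (fun x : ℝ => Complex.exp (t * x * Complex.I)) ν := fun ν _ =>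
      (integrable_const (1 : ℝ)).mono' (by fun_prop)
        (ae_of_all _ fun x => by
          rw [← Complex.ofReal_mul, Complex.norm_exp_ofReal_mul_I])
    rw [charFun_apply_real, integral_add_measure, integral_smul_measure, integral_smul_measure]
    · simp only [h, charFun_apply_real]
      simp [ENNReal.toReal_ofReal, h0, sub_nonneg.2 h1]
      ring
    · exact (hi _ inferInstance).smul_measure ENNReal.ofReal_ne_top
    · exact (hi _ inferInstance).smul_measure ENNReal.ofReal_ne_top

/-- A pointwise limit of characteristic functions that are equicontinuous at the origin is a
characteristic function. -/
lemma of_tendsto {ι : Type*} {l : Filter ι} [l.NeBot] {F : ι → ℝ → ℂ} {f : ℝ → ℂ}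
    (hF : ∀ i, IsCharFun (F i)) (heq : EquicontinuousAt F 0)
    (h : ∀ t, Tendsto (fun i => F i t) l (𝓝 (f t))) : IsCharFun f := by
  choose μ hμ hc using hF
  let P : ι → ProbabilityMeasure ℝ := fun i => ⟨μ i, hμ i⟩
  have h_tight : IsTightMeasureSet {((ν : ProbabilityMeasure ℝ) : Measure ℝ) | ν ∈ Set.range P} := by
    refine isTightMeasureSet_of_tendsto_measure_norm_gt ?_
    rw [ENNReal.tendsto_nhds_zero]
    intro ε hε
    obtain ⟨e, he, heε⟩ : ∃ e : ℝ, 0 < e ∧ ENNReal.ofReal e ≤ ε := by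
      by_cases ht : ε = ⊤
      · exact ⟨1, one_pos, by simp [ht]⟩
      · exact ⟨ε.toReal, ENNReal.toReal_pos hε.ne' ht, ENNReal.ofReal_toReal_le⟩
    obtain ⟨δ, hδ, hδe⟩ := Metric.equicontinuousAt_iff.1 heq (e / 2) (by positivity)
    filter_upwards [eventually_gt_atTop (2 / δ), eventually_gt_atTop 0] with r hr hr0
    refine iSup₂_le fun ν hν => ?_
    obtain ⟨_, ⟨i, rfl⟩, rfl⟩ := hν
    refine le_trans ?_ heε
    -- The tail beyond `r` is controlled by the mean of 1 - `F i` over [-2/r, 2/r], an interval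
    -- inside the δ-ball, hence uniformly in `i`.
    have hb := measureReal_abs_gt_le_integral_charFun (μ := μ i) hr0
    have h2 : ‖∫ t in (-2 * r⁻¹)..(2 * r⁻¹), 1 - charFun (μ i) t‖ ≤ e / 2 * |2 * r⁻¹ - -2 * r⁻¹| := by
      refine intervalIntegral.norm_integral_le_of_norm_le_const fun t ht => ?_
      have hrp : 0 < r⁻¹ := by positivity
      rw [Set.uIoc_of_le (by nlinarith)] at ht
      have h3 : 2 * r⁻¹ < δ := by
        rw [div_lt_iff₀ hδ] at hr
        rw [← div_eq_mul_inv, div_lt_iff₀ hr0]; linarith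
      have := hδe t (by
        rw [dist_zero_right, Real.norm_eq_abs, abs_lt]
        constructor <;> linarith [ht.1, ht.2]) i
      rw [hc, hc, charFun_zero, dist_eq_norm] at this
      simpa using this.le
    have h4 : |2 * r⁻¹ - -2 * r⁻¹| = 4 * r⁻¹ := by
      rw [abs_of_nonneg]
      · ring
      · have : 0 < r⁻¹ := by positivity
        linarith
    rw [h4] at h2
    have h5 : (μ i).real {x | r < |x|} ≤ e := by
      calc _ ≤ 2⁻¹ * r * (e / 2 * (4 * r⁻¹)) := hb.trans (by gcongr)
        _ = e := by field_simp; norm_num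
    rw [Measure.real, ← ENNReal.le_ofReal_iff_toReal_le (measure_ne_top _ _) he.le] at h5
    simpa [P] using h5
  have hcomp := isCompact_closure_of_isTightMeasureSet h_tight
  let U := Ultrafilter.of l
  obtain ⟨ν, -, hν⟩ := hcomp.ultrafilter_le_nhds (U.map P)
    (le_principal_iff.2 (mem_of_superset (by simp) subset_closure))
  have hν : Tendsto P U (𝓝 ν) := hν
  refine ⟨ν, inferInstance, fun t => tendsto_nhds_unique ((h t).mono_left (Ultrafilter.of_le l)) ?_⟩
  rw [ProbabilityMeasure.tendsto_iff_forall_integral_rclike_tendsto ℂ] at hν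
  simp_rw [hc, charFun_eq_integral_innerProbChar]
  exact hν (BoundedContinuousFunction.innerProbChar t)

lemma norm_one_sub_pow_le {z : ℂ} (hz : ‖z‖ ≤ 1) (n : ℕ) : ‖1 - z ^ n‖ ≤ n * ‖1 - z‖ := by
  induction n with
  | zero => simp
  | succ n ih =>
    calc ‖1 - z ^ (n + 1)‖ = ‖(1 - z ^ n) + z ^ n * (1 - z)‖ := by congr 1; ring
      _ ≤ ‖1 - z ^ n‖ + ‖z ^ n * (1 - z)‖ := norm_add_le _ _
      _ ≤ n * ‖1 - z‖ + 1 * ‖1 - z‖ := by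
        rw [norm_mul, norm_pow]
        gcongr
        exact pow_le_one₀ (norm_nonneg _) hz
      _ = _ := by push_cast; ring

/-- The characteristic function of a compound Poisson law. -/
lemma compoundPoisson {g : ℝ → ℂ} (hg : IsCharFun g) {r : ℝ} (hr : 0 ≤ r) :
    IsCharFun (fun t => Complex.exp (-(r * (1 - g t)))) := by
  -- Binomial approximation. For `k < r` the weight `r / k` is not a probability, and the constant 1
  -- fills in finitely many indices.
  let F : ℕ → ℝ → ℂ := fun k t =>
    if r ≤ k then (1 - ((r / k : ℝ) : ℂ) * (1 - g t)) ^ k else 1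
  have hp : ∀ k : ℕ, r ≤ k → 0 ≤ r / k ∧ r / k ≤ 1 := fun k hk =>
    ⟨by positivity, div_le_one_of_le₀ hk (by positivity)⟩
  have hF : ∀ k, IsCharFun (F k) := by
    intro k
    by_cases hk : r ≤ k
    · simpa only [F, if_pos hk] using (hg.convex_one (hp k hk).1 (hp k hk).2).pow k
    · simpa only [F, if_neg hk] using one
  refine of_tendsto (l := atTop) hF ?_ fun t => ?_
  · rw [Metric.equicontinuousAt_iff]
    intro ε hε
    obtain ⟨δ, hδ, h⟩ := Metric.continuousAt_iff.1 (hg.continuous.continuousAt (x := 0))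
      (ε / (r + 1)) (by positivity)
    refine ⟨δ, hδ, fun t ht k => ?_⟩
    have := h ht
    rw [hg.zero, dist_comm, dist_eq_norm, lt_div_iff₀ (by positivity)] at this
    rw [(hF k).zero, dist_eq_norm]
    by_cases hk : r ≤ k
    · simp only [F, if_pos hk]
      have hc := hg.convex_one (hp k hk).1 (hp k hk).2
      refine (norm_one_sub_pow_le (hc.norm_le_one t) k).trans_lt ?_
      rw [sub_sub_cancel, norm_mul, Complex.norm_real, Real.norm_of_nonneg (hp k hk).1]
      rcases eq_or_ne (k : ℝ) 0 with h0 | h0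
      · simpa [h0] using hε
      · rw [← mul_assoc, mul_div_cancel₀ _ h0]
        nlinarith [norm_nonneg (1 - g t)]
    · simpa only [F, if_neg hk, sub_self, norm_zero] using hε
  · have := Complex.tendsto_one_add_div_pow_exp (-(r * (1 - g t)))
    refine this.congr' ?_
    filter_upwards [eventually_ge_atTop ⌈r⌉₊] with k hk
    simp only [F, if_pos (Nat.ceil_le.1 hk)]
    push_cast
    congr 1
    ring

/-- Characteristic functions converging pointwise to a characteristic function are equicontinuous
at the origin. -/
lemma equicontinuousAt_of_tendsto {F : ℕ → ℝ → ℂ} {f : ℝ → ℂ} (hF : ∀ n, IsCharFun (F n))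
    (hf : IsCharFun f) (h : ∀ t, Tendsto (fun n => F n t) atTop (𝓝 (f t))) :
    EquicontinuousAt F 0 := by
  choose μ hμ hc using hF
  have ht := isTightMeasureSet_of_tendsto_charFun (μ := μ) (f := f) hf.continuous.continuousAt
    (by simpa only [hc] using h)
  rw [Metric.equicontinuousAt_iff]
  intro ε hε
  have h1 := tendsto_measure_norm_gt_of_isTightMeasureSet ht
  rw [ENNReal.tendsto_nhds_zero] at h1
  obtain ⟨r, hr, hr0⟩ := ((h1 (ENNReal.ofReal (ε / 8)) (by simpa using hε)).and
    (eventually_gt_atTop 0)).exists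
  -- On |x| ≤ r the integrand is at most |t| r < ε/2; the tail adds at most 2 · ε/8.
  refine ⟨ε / (2 * r), by positivity, fun t htδ n => ?_⟩
  rw [hc, hc, charFun_zero, dist_eq_norm]
  have hms : MeasurableSet {x : ℝ | r < ‖x‖} := measurableSet_lt (by fun_prop) (by fun_prop)
  have h2 : (μ n).real {x : ℝ | r < ‖x‖} ≤ ε / 8 := by
    rw [Measure.real, ← ENNReal.le_ofReal_iff_toReal_le (measure_ne_top _ _) (by positivity)]
    exact (le_iSup₂ (f := fun (ν : Measure ℝ) (_ : ν ∈ Set.range μ) => ν {x : ℝ | r < ‖x‖})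
      (μ n) ⟨n, rfl⟩).trans hr
  have h3 : ‖((μ n).real Set.univ : ℂ) - charFun (μ n) t‖ ≤
      ∫ x, (ε / 2 + Set.indicator {x : ℝ | r < ‖x‖} (fun _ => 2) x) ∂(μ n) := by
    have h4 : ((μ n).real Set.univ : ℂ) - charFun (μ n) t
        = ∫ x : ℝ, (1 - Complex.exp (t * x * Complex.I)) ∂(μ n) := by
      rw [charFun_apply_real, integral_sub (integrable_const _)]
      · simp
      · exact (integrable_const (1 : ℝ)).mono' (by fun_prop)
          (ae_of_all _ fun x => by
            rw [← Complex.ofReal_mul, Complex.norm_exp_ofReal_mul_I])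
    rw [h4]
    refine norm_integral_le_of_norm_le ?_ (ae_of_all _ fun x => ?_)
    · exact (integrable_const _).add ((integrable_const _).indicator hms)
    · have e1 : (t * x * Complex.I : ℂ) = Complex.I * ((t * x : ℝ) : ℂ) := by push_cast; ring
      by_cases hx : r < ‖x‖
      · rw [Set.indicator_of_mem (by exact hx)]
        refine (norm_sub_le _ _).trans ?_
        rw [mul_comm _ Complex.I, ← Complex.ofReal_mul, mul_comm Complex.I,
          Complex.norm_exp_ofReal_mul_I]
        simp; linarith
      · rw [Set.indicator_of_notMem (by exact hx), e1, norm_sub_rev]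
        refine Real.norm_exp_I_mul_ofReal_sub_one_le.trans ?_
        rw [dist_zero_right, lt_div_iff₀ (by positivity)] at htδ
        rw [norm_mul]
        push Not at hx
        nlinarith [norm_nonneg t, norm_nonneg x]
  refine h3.trans_lt ?_
  rw [integral_add (integrable_const _) ((integrable_const _).indicator hms),
    integral_indicator_const _ hms]
  simp only [integral_const, probReal_univ, smul_eq_mul]
  linarith

/-- Near-additivity of `1 - f` for a characteristic function `f`. -/
lemma norm_one_sub_add_le {f : ℝ → ℂ} (hf : IsCharFun f) (s h : ℝ) {c : ℝ} (hc : 0 < c) :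
    ‖(1 - f s) + (1 - f h) - (1 - f (s + h))‖ ≤ c * (1 - f s).re + (1 - f h).re / c := by
  obtain ⟨μ, hμ, hfe⟩ := hf
  have hi : ∀ t : ℝ, Integrable (fun x : ℝ => Complex.exp (t * x * Complex.I)) μ := fun t =>
    (integrable_const (1 : ℝ)).mono' (by fun_prop)
      (ae_of_all _ fun x => by
        rw [← Complex.ofReal_mul, Complex.norm_exp_ofReal_mul_I])
  have h1 : ∀ t : ℝ, 1 - f t = ∫ x : ℝ, (1 - Complex.exp (t * x * Complex.I)) ∂μ := by
    intro t
    rw [integral_sub (integrable_const _) (hi t), hfe, charFun_apply_real]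
    simp
  have hi1 : ∀ t : ℝ, Integrable (fun x : ℝ => 1 - Complex.exp (t * x * Complex.I)) μ :=
    fun t => (integrable_const _).sub (hi t)
  have hre : ∀ t : ℝ, (1 - f t).re = ∫ x : ℝ, (1 - Real.cos (t * x)) ∂μ := by
    intro t
    rw [h1, ← RCLike.re_eq_complex_re, ← integral_re (hi1 t)]
    refine integral_congr_ae (ae_of_all _ fun x => ?_)
    have : (t * x * Complex.I : ℂ) = ((t * x : ℝ) : ℂ) * Complex.I := by push_cast; ring
    simp only [this, RCLike.re_eq_complex_re, Complex.sub_re, Complex.one_re,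
      Complex.exp_ofReal_mul_I_re]
  have hic : ∀ t : ℝ, Integrable (fun x : ℝ => 1 - Real.cos (t * x)) μ := fun t =>
    (integrable_const (2 : ℝ)).mono' (by fun_prop) (ae_of_all _ fun x => by
      rw [Real.norm_eq_abs, abs_le]
      constructor <;> linarith [Real.cos_le_one (t * x), Real.neg_one_le_cos (t * x)])
  rw [hre, hre, h1, h1, h1, ← integral_add (hi1 s) (hi1 h), ← integral_sub (by exact (hi1 s).add (hi1 h))
    (hi1 (s + h)), ← integral_const_mul, ← integral_div, ← integral_add (by exact (hic s).const_mul c)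
    (by exact (hic h).div_const c)]
  refine norm_integral_le_of_norm_le (((hic s).const_mul c).add ((hic h).div_const c))
    (ae_of_all _ fun x => ?_)
  -- The defect factors as (1 - e^{isx})(1 - e^{ihx}). Since |1 - e^{iy}|² = 2(1 - cos y), the bound
  -- is AB ≤ cA²/2 + B²/(2c).
  have e1 : (1 - Complex.exp (s * x * Complex.I)) + (1 - Complex.exp (h * x * Complex.I))
      - (1 - Complex.exp ((s + h : ℝ) * x * Complex.I))
      = (1 - Complex.exp (s * x * Complex.I)) * (1 - Complex.exp (h * x * Complex.I)) := by
    push_cast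
    rw [add_mul, add_mul, Complex.exp_add]
    ring
  have e2 : ∀ t : ℝ, ‖1 - Complex.exp (t * x * Complex.I)‖ ^ 2 = 2 * (1 - Real.cos (t * x)) := by
    intro t
    have : (t * x * Complex.I : ℂ) = ((t * x : ℝ) : ℂ) * Complex.I := by push_cast; ring
    rw [this, Complex.sq_norm, Complex.normSq_apply, Complex.sub_re, Complex.sub_im,
      Complex.exp_ofReal_mul_I_re, Complex.exp_ofReal_mul_I_im, Complex.one_re, Complex.one_im]
    nlinarith [Real.sin_sq_add_cos_sq (t * x)]
  rw [e1, norm_mul]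
  have e3 := e2 s
  have e4 := e2 h
  set A := ‖1 - Complex.exp (s * x * Complex.I)‖
  set B := ‖1 - Complex.exp (h * x * Complex.I)‖
  have e5 : 1 - Real.cos (s * x) = A ^ 2 / 2 := by linarith
  have e6 : 1 - Real.cos (h * x) = B ^ 2 / 2 := by linarith
  rw [e5, e6]
  have : c * (A ^ 2 / 2) + B ^ 2 / 2 / c - A * B = (c * A - B) ^ 2 / (2 * c) := by
    field_simp; ring
  have h0 : 0 ≤ (c * A - B) ^ 2 / (2 * c) := by positivity
  linarith

end IsCharFun

/-! ### Characteristic exponents of infinitely divisible laws. -/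

/-- The Laplace transform of a measure on the line, with complex argument. -/
noncomputable def laplace (ρ : Measure ℝ) (z : ℂ) : ℂ :=
  ∫ u : ℝ, Complex.exp (-(z * (u : ℂ))) ∂ρ

/-- A continuous additive function on the line is linear. -/
lemma eq_mul_of_continuous_of_add {E : Type*} [NormedAddCommGroup E] [NormedSpace ℝ E]
    {q : ℝ → E} (hc : Continuous q) (ha : ∀ s t, q (s + t) = q s + q t) (t : ℝ) :
    q t = t • q 1 := by
  have := map_real_smul (AddMonoidHom.mk' q ha) (by exact hc) t 1
  simpa using this

/-- Characteristic exponents of infinitely divisible laws: `exp (-u ψ)` is a characteristic function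
for all `u ≥ 0`. -/
structure IsLevyExponent (ψ : ℝ → ℂ) : Prop where
  continuous : Continuous ψ
  zero : ψ 0 = 0
  charFun : ∀ u : ℝ, 0 ≤ u → IsCharFun (fun t => Complex.exp (-(u * ψ t)))
  norm_add_le : ∀ s h c : ℝ, 0 < c → ‖ψ s + ψ h - ψ (s + h)‖ ≤ c * (ψ s).re + (ψ h).re / c

/-- The near-additivity bound is homogeneous, so the factor `r` passes through it. It also survives
pointwise limits, which is why it is carried as a field. -/
lemma IsCharFun.isLevyExponent {g : ℝ → ℂ} (hg : IsCharFun g) {r : ℝ} (hr : 0 ≤ r) :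
    IsLevyExponent (fun t => r * (1 - g t)) where
  continuous := by have := hg.continuous; fun_prop
  zero := by simp [hg.zero]
  charFun u hu := by
    convert hg.compoundPoisson (mul_nonneg hu hr) using 3
    push_cast; ring
  norm_add_le s h c hc := by
    have := hg.norm_one_sub_add_le s h hc
    rw [← mul_add, ← mul_sub, norm_mul, Complex.norm_real, Real.norm_of_nonneg hr,
      Complex.re_ofReal_mul, Complex.re_ofReal_mul]
    calc _ ≤ r * _ := mul_le_mul_of_nonneg_left this hr
      _ = _ := by ring

namespace IsLevyExponent

variable {ψ : ℝ → ℂ}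

lemma re_nonneg (hψ : IsLevyExponent ψ) (t : ℝ) : 0 ≤ (ψ t).re := by
  have := (hψ.charFun 1 zero_le_one).norm_le_one t
  rw [Complex.norm_exp, Real.exp_le_one_iff] at this
  simpa using this

lemma comp_neg (hψ : IsLevyExponent ψ) : IsLevyExponent (fun t => ψ (-t)) where
  continuous := hψ.continuous.comp continuous_neg
  zero := by simp [hψ.zero]
  charFun u hu := by simpa using (hψ.charFun u hu).comp_mul (-1)
  norm_add_le s h c hc := by
    have := hψ.norm_add_le (-s) (-h) c hc
    rwa [← neg_add] at this

lemma re_neg (hψ : IsLevyExponent ψ) (t : ℝ) : (ψ (-t)).re = (ψ t).re := by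
  have h := (hψ.charFun 1 zero_le_one).neg_eq_conj t
  have := congrArg norm h
  rw [RCLike.norm_conj, Complex.norm_exp, Complex.norm_exp, Real.exp_eq_exp] at this
  simpa using this

/-- When Re ψ(s) = 0 the first term of the near-additivity bound vanishes for every `c`, and large
`c` kills the second. -/
lemma add_of_re_eq_zero (hψ : IsLevyExponent ψ) {s : ℝ} (hs : (ψ s).re = 0) (h : ℝ) :
    ψ (s + h) = ψ s + ψ h := by
  have h1 : ∀ ε > 0, ‖ψ s + ψ h - ψ (s + h)‖ ≤ ε := by
    intro ε hε
    have h0 := hψ.re_nonneg h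
    refine (hψ.norm_add_le s h (((ψ h).re + 1) / ε) (by positivity)).trans ?_
    rw [hs, mul_zero, zero_add, div_div_eq_mul_div, div_le_iff₀ (by positivity)]
    nlinarith
  have := le_of_forall_pos_le_add (a := ‖ψ s + ψ h - ψ (s + h)‖) (b := 0)
    (fun ε hε => by simpa using h1 ε hε)
  exact (sub_eq_zero.1 (norm_le_zero_iff.1 this)).symm

lemma eq_linear_of_re_eq_zero (hψ : IsLevyExponent ψ) (h : ∀ t, (ψ t).re = 0) :
    ∃ β : ℝ, ∀ t : ℝ, ψ t = Complex.I * β * t := by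
  refine ⟨(ψ 1).im, fun t => ?_⟩
  rw [eq_mul_of_continuous_of_add hψ.continuous (fun s t => hψ.add_of_re_eq_zero (h s) t) t]
  apply Complex.ext <;> simp [h]
  ring

/-- Unless the law is a point mass, the real part of the exponent is positive on a dense set. -/
lemma dense_re_pos (hψ : IsLevyExponent ψ) (hnd : ¬ ∃ β : ℝ, ∀ t : ℝ, ψ t = Complex.I * β * t) :
    Dense {t : ℝ | 0 < (ψ t).re} := by
  by_contra hd
  apply hnd
  apply hψ.eq_linear_of_re_eq_zero
  rw [Metric.dense_iff] at hd
  push Not at hd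
  obtain ⟨x, r, hr, hx⟩ := hd
  have hball : ∀ h : ℝ, |h| < r → (ψ (x + h)).re = 0 := by
    intro h hh
    refine le_antisymm (not_lt.1 fun hpos => ?_) (hψ.re_nonneg _)
    have : x + h ∈ Metric.ball x r ∩ {t : ℝ | 0 < (ψ t).re} :=
      ⟨by simpa [Real.dist_eq] using hh, hpos⟩
    rw [hx] at this
    exact this
  have hx0 : (ψ x).re = 0 := by simpa using hball 0 (by simpa using hr)
  -- Zeros of Re ψ are closed under addition and negation: a ball of zeros moves to the origin, and
  -- its multiples cover the line.
  have hsmall : ∀ h : ℝ, |h| < r → (ψ h).re = 0 := by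
    intro h hh
    have := hψ.add_of_re_eq_zero (hball h hh) (-x)
    rw [show x + h + -x = h by ring] at this
    rw [this, Complex.add_re, hball h hh, hψ.re_neg, hx0, add_zero]
  intro t
  obtain ⟨n, hn⟩ := exists_nat_gt (|t| / r)
  have hn0 : (0 : ℝ) < n := (by positivity : 0 ≤ |t| / r).trans_lt hn
  have h1 : (ψ (t / n)).re = 0 := by
    apply hsmall
    rw [abs_div, abs_of_pos hn0, div_lt_iff₀ hn0]
    rwa [div_lt_iff₀ hr, mul_comm] at hn
  have h2 : ∀ k : ℕ, (ψ (k * (t / n))).re = 0 := by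
    intro k
    induction k with
    | zero => simp [hψ.zero]
    | succ k ih =>
      rw [Nat.cast_succ, add_one_mul, hψ.add_of_re_eq_zero ih, Complex.add_re, ih, h1, add_zero]
  simpa [mul_div_cancel₀ _ hn0.ne'] using h2 n

/-- The convolution semigroup with characteristic functions `exp (-u ψ)`. -/
lemma exists_semigroup (hψ : IsLevyExponent ψ) : ∃ ν : ℝ → ProbabilityMeasure ℝ, Continuous ν ∧
    ∀ u : ℝ, 0 ≤ u → ∀ t : ℝ, MeasureTheory.charFun (ν u : Measure ℝ) t =
      Complex.exp (-(u * ψ t)) := by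
  -- Clamping `u` at 0 gives a family that is continuous on all of ℝ; negative times will be ρ-null.
  have h : ∀ u : ℝ, ∃ μ : ProbabilityMeasure ℝ, ∀ t : ℝ, MeasureTheory.charFun (μ : Measure ℝ) t =
      Complex.exp (-((max u 0 : ℝ) * ψ t)) := by
    intro u
    obtain ⟨μ, hμ, h⟩ := hψ.charFun (max u 0) (le_max_right _ _)
    exact ⟨⟨μ, hμ⟩, fun t => (h t).symm⟩
  choose ν hν using h
  refine ⟨ν, ?_, fun u hu t => by rw [hν, max_eq_left hu]⟩
  refine SeqContinuous.continuous fun x u hx => ?_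
  refine ProbabilityMeasure.tendsto_of_tendsto_charFun fun t => ?_
  simp only [Function.comp_apply, hν]
  have : Continuous fun u : ℝ => Complex.exp (-((max u 0 : ℝ) * ψ t)) := by fun_prop
  exact (this.tendsto u).comp hx

end IsLevyExponent

/-! ### Subordination: mixtures of convolution semigroups. -/

/-- By the portmanteau theorem the mass of an open set is lower semicontinuous in `u`, and open sets
form a generating π-system. -/
lemma measurable_coe_of_continuous {ν : ℝ → ProbabilityMeasure ℝ} (hν : Continuous ν) :
    Measurable (fun u => (ν u : Measure ℝ)) := by
  refine Measurable.measure_of_isPiSystem_of_isProbabilityMeasure (S := {s | IsOpen s})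
    (BorelSpace.measurable_eq (α := ℝ)) isPiSystem_isOpen fun s hs => ?_
  refine LowerSemicontinuous.measurable fun u y hy => ?_
  exact eventually_lt_of_lt_liminf
    (hy.trans_le (ProbabilityMeasure.le_liminf_measure_open_of_tendsto (hν.tendsto u) hs))

/-- The mixture of a continuous family of laws. -/
lemma exists_mixture (ρ : Measure ℝ) [IsProbabilityMeasure ρ] {ν : ℝ → ProbabilityMeasure ℝ}
    (hν : Continuous ν) : ∃ m : Measure ℝ, IsProbabilityMeasure m ∧
      (∀ f : ℝ → ℝ, Continuous f → (∃ C, ∀ x, ‖f x‖ ≤ C) →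
        ∫ x, f x ∂m = ∫ u, ∫ x, f x ∂(ν u : Measure ℝ) ∂ρ) ∧
      (∀ t, charFun m t = ∫ u, charFun (ν u : Measure ℝ) t ∂ρ) := by
  let κ : ProbabilityTheory.Kernel ℝ ℝ := ⟨fun u => ν u, measurable_coe_of_continuous hν⟩
  have hκ : ProbabilityTheory.IsMarkovKernel κ := ⟨fun u => by
    change IsProbabilityMeasure (ν u : Measure ℝ); infer_instance⟩
  have key : ∀ {E : Type} [NormedAddCommGroup E] [NormedSpace ℝ E] [SecondCountableTopology E]
      (f : ℝ → E), Continuous f → (∃ C, ∀ x, ‖f x‖ ≤ C) →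
      ∫ x, f x ∂(ρ.bind κ) = ∫ u, ∫ x, f x ∂(ν u : Measure ℝ) ∂ρ := by
    intro E _ _ _ f hf hC
    obtain ⟨C, hC⟩ := hC
    have hi : Integrable f (ρ.bind κ) := (integrable_const C).mono' hf.aestronglyMeasurable
      (ae_of_all _ hC)
    rw [Measure.comp_eq_comp_const_apply] at hi ⊢
    rw [ProbabilityTheory.Kernel.integral_comp hi]
    rfl
  refine ⟨ρ.bind κ, inferInstance, fun f hf hC => key f hf hC, fun t => ?_⟩
  simp only [charFun_apply_real]
  refine key _ (by fun_prop) ⟨1, fun x => ?_⟩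
  rw [← Complex.ofReal_mul, Complex.norm_exp_ofReal_mul_I]

lemma ae_nonneg_of_measure_Iio {ρ : Measure ℝ} (h0 : ρ (Set.Iio 0) = 0) : ∀ᵐ u ∂ρ, 0 ≤ u := by
  rw [ae_iff]
  simpa [Set.Iio] using h0

section

variable {ρ : Measure ℝ} (h0 : ρ (Set.Iio 0) = 0)
include h0

lemma integral_charFun_semigroup {ψ : ℝ → ℂ} {ν : ℝ → ProbabilityMeasure ℝ}
    (h : ∀ u : ℝ, 0 ≤ u → ∀ t : ℝ, charFun (ν u : Measure ℝ) t = Complex.exp (-(u * ψ t))) (t : ℝ) :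
    ∫ u, charFun (ν u : Measure ℝ) t ∂ρ = laplace ρ (ψ t) := by
  refine integral_congr_ae ?_
  filter_upwards [ae_nonneg_of_measure_Iio h0] with u hu
  rw [h u hu, mul_comm]

variable [IsProbabilityMeasure ρ]

lemma IsLevyExponent.isCharFun_laplace {ψ : ℝ → ℂ} (hψ : IsLevyExponent ψ) :
    IsCharFun (fun t => laplace ρ (ψ t)) := by
  obtain ⟨ν, hν, h⟩ := hψ.exists_semigroup
  obtain ⟨m, hm, -, hc⟩ := exists_mixture ρ hν
  exact ⟨m, hm, fun t => by rw [hc, integral_charFun_semigroup h0 h]⟩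

/-- If two subordinated laws coincide, so do the integrals of bounded continuous functions. -/
lemma integral_eq_of_laplace_eq {ψ ψ' : ℝ → ℂ} {ν ν' : ℝ → ProbabilityMeasure ℝ}
    (hν : Continuous ν) (hν' : Continuous ν')
    (h : ∀ u : ℝ, 0 ≤ u → ∀ t : ℝ, charFun (ν u : Measure ℝ) t = Complex.exp (-(u * ψ t)))
    (h' : ∀ u : ℝ, 0 ≤ u → ∀ t : ℝ, charFun (ν' u : Measure ℝ) t = Complex.exp (-(u * ψ' t)))
    (he : ∀ t, laplace ρ (ψ t) = laplace ρ (ψ' t)) {f : ℝ → ℝ} (hf : Continuous f)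
    (hC : ∃ C, ∀ x, ‖f x‖ ≤ C) :
    ∫ u, ∫ x, f x ∂(ν u : Measure ℝ) ∂ρ = ∫ u, ∫ x, f x ∂(ν' u : Measure ℝ) ∂ρ := by
  obtain ⟨m, hm, hi, hc⟩ := exists_mixture ρ hν
  obtain ⟨m', hm', hi', hc'⟩ := exists_mixture ρ hν'
  have : m = m' := Measure.ext_of_charFun (funext fun t => by
    rw [hc, hc', integral_charFun_semigroup h0 h, integral_charFun_semigroup h0 h', he])
  rw [← hi f hf hC, ← hi' f hf hC, this]

end

/-! ### The Laplace transform on the closed right half-plane. -/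

section Laplace

variable {ρ : Measure ℝ} [IsProbabilityMeasure ρ]

lemma norm_exp_neg_mul_le {z : ℂ} (hz : 0 ≤ z.re) {u : ℝ} (hu : 0 ≤ u) :
    ‖Complex.exp (-(z * u))‖ ≤ 1 := by
  rw [Complex.norm_exp, Real.exp_le_one_iff]
  simp
  positivity

lemma integrable_exp_neg_mul (h0 : ρ (Set.Iio 0) = 0) {z : ℂ} (hz : 0 ≤ z.re) :
    Integrable (fun u : ℝ => Complex.exp (-(z * u))) ρ := by
  refine (integrable_const (1 : ℝ)).mono' (by fun_prop) ?_
  filter_upwards [ae_nonneg_of_measure_Iio h0] with u hu using norm_exp_neg_mul_le hz hu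

lemma integrable_rexp_neg_mul (h0 : ρ (Set.Iio 0) = 0) {x : ℝ} (hx : 0 ≤ x) :
    Integrable (fun u : ℝ => Real.exp (-(x * u))) ρ := by
  refine (integrable_const (1 : ℝ)).mono' (by fun_prop) ?_
  filter_upwards [ae_nonneg_of_measure_Iio h0] with u hu
  rw [Real.norm_eq_abs, Real.abs_exp, Real.exp_le_one_iff]
  simp
  positivity

lemma continuousOn_laplace (h0 : ρ (Set.Iio 0) = 0) :
    ContinuousOn (laplace ρ) {z | 0 ≤ z.re} := by
  intro z _
  refine tendsto_integral_filter_of_dominated_convergence (fun _ => (1 : ℝ))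
    (Eventually.of_forall fun w => by fun_prop) ?_ (integrable_const _) ?_
  · filter_upwards [self_mem_nhdsWithin] with w hw
    filter_upwards [ae_nonneg_of_measure_Iio h0] with u hu using norm_exp_neg_mul_le hw hu
  · refine ae_of_all _ fun u => ?_
    have : Continuous fun w : ℂ => Complex.exp (-(w * u)) := by fun_prop
    exact (this.tendsto z).mono_left nhdsWithin_le_nhds

omit [IsProbabilityMeasure ρ] in
lemma laplace_ofReal (x : ℝ) : laplace ρ x = ((∫ u, Real.exp (-(x * u)) ∂ρ : ℝ) : ℂ) := by
  rw [laplace, ← integral_complex_ofReal]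
  simp

lemma integral_exp_neg_mul_lt (h0 : ρ (Set.Iio 0) = 0) (h1 : ρ (Set.Ioi 0) ≠ 0) {x y : ℝ}
    (hx : 0 ≤ x) (hxy : x < y) :
    ∫ u, Real.exp (-(y * u)) ∂ρ < ∫ u, Real.exp (-(x * u)) ∂ρ := by
  have hix := integrable_rexp_neg_mul h0 hx
  have hiy := integrable_rexp_neg_mul h0 (hx.trans hxy.le)
  have hle : ∀ᵐ u ∂ρ, Real.exp (-(y * u)) ≤ Real.exp (-(x * u)) := by
    filter_upwards [ae_nonneg_of_measure_Iio h0] with u hu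
    rw [Real.exp_le_exp]
    nlinarith
  refine lt_of_le_of_ne (integral_mono_ae hiy hix hle) fun he => h1 ?_
  have h2 := (integral_eq_iff_of_ae_le hiy hix hle).1 he
  refine measure_mono_null (fun u hu => ?_) (ae_iff.1 h2)
  simp only [Set.mem_Ioi] at hu
  simp only [Set.mem_ofPred_eq, Real.exp_eq_exp]
  nlinarith

lemma eq_of_integral_exp_neg_mul_eq (h0 : ρ (Set.Iio 0) = 0) (h1 : ρ (Set.Ioi 0) ≠ 0) {x y : ℝ}
    (hx : 0 ≤ x) (hy : 0 ≤ y) (h : ∫ u, Real.exp (-(x * u)) ∂ρ = ∫ u, Real.exp (-(y * u)) ∂ρ) :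
    x = y := by
  rcases lt_trichotomy x y with hl | he | hg
  · exact absurd h (integral_exp_neg_mul_lt h0 h1 hx hl).ne'
  · exact he
  · exact absurd h (integral_exp_neg_mul_lt h0 h1 hy hg).ne

lemma analyticOnNhd_laplace (h0 : ρ (Set.Iio 0) = 0) :
    AnalyticOnNhd ℂ (laplace ρ) {z | 0 < z.re} := by
  have he : laplace ρ = fun z => ProbabilityTheory.complexMGF id ρ (-z) := by
    funext z; simp [laplace, ProbabilityTheory.complexMGF]
  intro z hz
  rw [he]
  have hz' : (-z).re ∈ interior (ProbabilityTheory.integrableExpSet id ρ) := by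
    refine interior_mono (s := Set.Iio 0) (fun x hx => ?_) (by simpa using hz)
    have := integrable_rexp_neg_mul h0 (x := -x) (by simpa using (le_of_lt hx))
    simpa [ProbabilityTheory.integrableExpSet] using this
  exact (ProbabilityTheory.analyticAt_complexMGF hz').fun_comp analyticAt_id.neg

/-- Level sets of the Laplace transform are discrete in the open half-plane. -/
lemma eventually_laplace_ne (h0 : ρ (Set.Iio 0) = 0) (h1 : ρ (Set.Ioi 0) ≠ 0) {z : ℂ}
    (hz : 0 < z.re) (c : ℂ) : ∀ᶠ w in 𝓝[≠] z, laplace ρ w ≠ c := by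
  by_contra hf
  have hf : ∃ᶠ w in 𝓝[≠] z, laplace ρ w = c := by
    simpa only [Filter.Frequently, ne_eq] using hf
  have hpre : IsPreconnected {z : ℂ | 0 < z.re} := (convex_halfSpace_re_gt 0).isPreconnected
  -- By the identity theorem φ would be constant on the half-plane, against strict monotonicity at 1
  -- and 2.
  have := (analyticOnNhd_laplace h0).eqOn_of_preconnected_of_frequently_eq
    (analyticOnNhd_const (v := c)) hpre hz hf
  have e1 := this (show (1 : ℂ) ∈ {z : ℂ | 0 < z.re} by simp)
  have e2 := this (show (2 : ℂ) ∈ {z : ℂ | 0 < z.re} by simp)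
  have e3 : laplace ρ ((1 : ℝ) : ℂ) = laplace ρ ((2 : ℝ) : ℂ) := by
    push_cast; rw [e1, e2]
  rw [laplace_ofReal, laplace_ofReal, Complex.ofReal_inj] at e3
  have := eq_of_integral_exp_neg_mul_eq h0 h1 zero_le_one zero_le_two e3
  norm_num at this

/-- The origin is isolated in the set where the Laplace transform takes the value `1`. -/
lemma exists_laplace_ne_one (h0 : ρ (Set.Iio 0) = 0) (h1 : ρ (Set.Ioi 0) ≠ 0) :
    ∃ r > 0, ∀ z : ℂ, 0 ≤ z.re → z ≠ 0 → ‖z‖ ≤ r → laplace ρ z ≠ 1 := by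
  obtain ⟨n, hn⟩ : ∃ n : ℕ, ρ (Set.Ioc 0 (n : ℝ)) ≠ 0 := by
    by_contra! h
    apply h1
    have : Set.Ioi (0 : ℝ) = ⋃ n : ℕ, Set.Ioc 0 (n : ℝ) := by
      ext x
      simp only [Set.mem_Ioi, Set.mem_iUnion, Set.mem_Ioc, exists_and_left]
      exact ⟨fun hx => ⟨hx, exists_nat_ge x⟩, fun hx => hx.1⟩
    rw [this]
    exact measure_iUnion_null h
  -- φ(z) = 1 forces e^{-zu} = 1 for ρ-almost every u. With this radius |zu| < 1 < 2π on (0, n], an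
  -- interval of positive mass.
  refine ⟨1 / (n + 1), by positivity, fun z hz hz0 hzr he => hn ?_⟩
  have hi := integrable_exp_neg_mul h0 hz
  have h2 : ∫ u : ℝ, (1 - (Complex.exp (-(z * u))).re) ∂ρ = 0 := by
    rw [integral_sub (integrable_const _) (by exact hi.re)]
    have : ∫ u : ℝ, (Complex.exp (-(z * u))).re ∂ρ = (laplace ρ z).re := by
      rw [laplace, ← RCLike.re_eq_complex_re, ← integral_re hi]
    rw [this, he]
    simp
  have hle : ∀ᵐ u : ℝ ∂ρ, 0 ≤ 1 - (Complex.exp (-(z * u))).re := by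
    filter_upwards [ae_nonneg_of_measure_Iio h0] with u hu
    have := (Complex.re_le_norm _).trans (norm_exp_neg_mul_le hz hu)
    linarith
  have h3 := (integral_eq_zero_iff_of_nonneg_ae hle ((integrable_const _).sub hi.re)).1 h2
  refine measure_mono_null (fun u hu => ?_)
    (ae_iff.1 (h3.and (ae_nonneg_of_measure_Iio h0)))
  simp only [Set.mem_ofPred_eq, Pi.zero_apply, not_and]
  intro h4
  exfalso
  have hn1 := norm_exp_neg_mul_le hz hu.1.le
  have h5 : Complex.exp (-(z * u)) = 1 := by
    have hre : (Complex.exp (-(z * u))).re = 1 := by linarith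
    have := Complex.sq_norm (Complex.exp (-(z * u)))
    rw [Complex.normSq_apply, hre] at this
    have him : (Complex.exp (-(z * u))).im = 0 := by
      nlinarith [norm_nonneg (Complex.exp (-(z * u))), mul_self_nonneg (Complex.exp (-(z * u))).im]
    exact Complex.ext hre him
  obtain ⟨k, hk⟩ := Complex.exp_eq_one_iff.1 h5
  have h6 : ‖z‖ * u < 1 := by
    calc ‖z‖ * u ≤ 1 / (n + 1) * n := by
          apply mul_le_mul hzr hu.2 hu.1.le (by positivity)
      _ < 1 := by rw [one_div_mul_eq_div, div_lt_one (by positivity)]; linarith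
  have h7 : ‖z‖ * u = |(k : ℝ)| * (2 * Real.pi) := by
    have := congrArg norm hk
    rw [norm_neg, norm_mul, Complex.norm_real, Real.norm_of_nonneg hu.1.le] at this
    rw [this]
    simp [abs_of_pos Real.pi_pos]
  have hk0 : k ≠ 0 := by
    rintro rfl
    have : ‖z‖ * u = 0 := by simpa using h7
    rcases mul_eq_zero.1 this with h | h
    · exact hz0 (norm_eq_zero.1 h)
    · exact hu.1.ne' h
  have : (1 : ℝ) ≤ |(k : ℝ)| := by exact_mod_cast Int.one_le_abs hk0
  nlinarith [Real.pi_gt_three]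

end Laplace

/-! ### Equicontinuous families of exponents. -/

section Families

variable {ι : Type*} {ψ : ι → ℝ → ℂ}

/-- If the subordinated laws are equicontinuous at the origin, so are the exponents. -/
lemma equicontinuousAt_of_laplace {ρ : Measure ℝ} [IsProbabilityMeasure ρ]
    (h0 : ρ (Set.Iio 0) = 0) (h1 : ρ (Set.Ioi 0) ≠ 0) (hψ : ∀ i, IsLevyExponent (ψ i))
    (he : EquicontinuousAt (fun i t => laplace ρ (ψ i t)) 0) : EquicontinuousAt ψ 0 := by
  obtain ⟨r, hr, hne⟩ := exists_laplace_ne_one h0 h1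
  rw [Metric.equicontinuousAt_iff] at he ⊢
  intro ε hε
  set e := min ε r
  have he0 : 0 < e := lt_min hε hr
  -- |1 - φ| has a positive minimum on this half-circle. An exponent starts at 0, so to reach norm
  -- `e` at `t` it must cross the half-circle at some time between 0 and `t`.
  have hcomp : IsCompact ({z : ℂ | 0 ≤ z.re} ∩ Metric.sphere 0 e) :=
    (isCompact_sphere _ _).inter_left (isClosed_le continuous_const Complex.continuous_re)
  obtain ⟨z₀, hz₀, hmin⟩ := hcomp.exists_isMinOn (f := fun z => dist 1 (laplace ρ z))
    ⟨(e : ℂ), by simp [he0.le], by simp [he0.le]⟩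
    (Continuous.comp_continuousOn (continuous_const.dist continuous_id) ((continuousOn_laplace h0).mono Set.inter_subset_left))
  have hz₀n : ‖z₀‖ = e := by simpa using hz₀.2
  have hm : 0 < dist 1 (laplace ρ z₀) := by
    rw [dist_pos]
    refine (hne z₀ hz₀.1 (fun h => ?_) (hz₀n.le.trans (min_le_right _ _))).symm
    rw [h, norm_zero] at hz₀n
    exact he0.ne hz₀n
  obtain ⟨δ, hδ, hd⟩ := he _ hm
  refine ⟨δ, hδ, fun t ht i => ?_⟩
  rw [(hψ i).zero, dist_comm, dist_zero_right]
  by_contra hcon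
  have hcon : e ≤ ‖ψ i t‖ := (min_le_left _ _).trans (not_lt.1 hcon)
  obtain ⟨s, hs, hse⟩ := intermediate_value_uIcc (f := fun s => ‖ψ i s‖) (a := 0) (b := t)
    (hψ i).continuous.norm.continuousOn (show e ∈ _ by
      rw [(hψ i).zero, norm_zero]
      exact Set.mem_uIcc.2 (Or.inl ⟨he0.le, hcon⟩))
  have hst : dist s 0 < δ := by
    refine lt_of_le_of_lt ?_ ht
    rw [dist_zero_right, dist_zero_right, Real.norm_eq_abs, Real.norm_eq_abs]
    simpa using Set.abs_sub_left_of_mem_uIcc hs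
  have h2 := hd s hst i
  rw [(hψ i).zero] at h2
  have h3 : laplace ρ 0 = 1 := by simp [laplace]
  rw [h3] at h2
  exact absurd h2 (not_lt.2 (hmin ⟨(hψ i).re_nonneg s, by simpa using hse⟩))

variable (hψ : ∀ i, IsLevyExponent (ψ i)) (he : EquicontinuousAt ψ 0)
include hψ he

/-- Near-additivity with c = 1 gives |ψ(2s)| ≤ 4|ψ(s)|, so a bound near 0 propagates by doubling. -/
lemma exists_norm_le_of_equicontinuousAt (t : ℝ) : ∃ M : ℝ, ∀ i, ‖ψ i t‖ ≤ M := by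
  rw [Metric.equicontinuousAt_iff] at he
  obtain ⟨δ, hδ, hd⟩ := he 1 one_pos
  have key : ∀ k : ℕ, ∀ t : ℝ, |t| < 2 ^ k * δ → ∀ i, ‖ψ i t‖ ≤ 4 ^ k := by
    intro k
    induction k with
    | zero =>
      intro t ht i
      have := hd t (by simpa [Real.dist_eq] using ht) i
      rw [(hψ i).zero, dist_comm, dist_zero_right] at this
      simpa using this.le
    | succ k ih =>
      intro t ht i
      have h1 := ih (t / 2) (by rw [abs_div, abs_two, div_lt_iff₀ two_pos]; rw [pow_succ] at ht; linarith) i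
      have h2 := (hψ i).norm_add_le (t / 2) (t / 2) 1 one_pos
      rw [add_halves] at h2
      have h3 : ‖ψ i t‖ ≤ ‖ψ i (t / 2) + ψ i (t / 2) - ψ i t‖ + ‖ψ i (t / 2) + ψ i (t / 2)‖ := by
        rw [norm_sub_rev]; simpa using norm_add_le (ψ i t - (ψ i (t / 2) + ψ i (t / 2)))
          (ψ i (t / 2) + ψ i (t / 2))
      have h4 := norm_add_le (ψ i (t / 2)) (ψ i (t / 2))
      have h5 := Complex.re_le_norm (ψ i (t / 2))
      rw [pow_succ]
      linarith
  obtain ⟨k, hk⟩ := pow_unbounded_of_one_lt (|t| / δ) (one_lt_two)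
  exact ⟨4 ^ k, key k t (by rwa [div_lt_iff₀ hδ] at hk)⟩

/-- The increment ψ(t) - ψ(s) differs from ψ(t - s) by at most c Re ψ(s) + Re ψ(t - s)/c: first
choose `c` small against the bound at `s`, then `t` close to `s`. -/
lemma equicontinuous_of_isLevyExponent : Equicontinuous ψ := by
  intro s
  obtain ⟨M, hM⟩ := exists_norm_le_of_equicontinuousAt hψ he s
  rw [Metric.equicontinuousAt_iff] at he ⊢
  intro ε hε
  set c := ε / (4 * (|M| + 1))
  have hc : 0 < c := by positivity
  obtain ⟨δ, hδ, hd⟩ := he (min (ε / 4) (c * ε / 4)) (by positivity)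
  refine ⟨δ, hδ, fun t ht i => ?_⟩
  have h1 := hd (t - s) (by simpa [Real.dist_eq] using ht) i
  rw [(hψ i).zero, dist_comm, dist_zero_right, lt_min_iff] at h1
  have h2 := (hψ i).norm_add_le s (t - s) c hc
  rw [add_sub_cancel] at h2
  have h3 : c * (ψ i s).re ≤ ε / 4 := by
    have : (ψ i s).re ≤ |M| + 1 :=
      (Complex.re_le_norm _).trans ((hM i).trans ((le_abs_self M).trans (by linarith)))
    calc c * (ψ i s).re ≤ c * (|M| + 1) := by gcongr
      _ = ε / 4 := by simp only [c]; field_simp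
  have h4 : (ψ i (t - s)).re / c ≤ ε / 4 := by
    rw [div_le_iff₀ hc]
    linarith [Complex.re_le_norm (ψ i (t - s))]
  have h5 : dist (ψ i s) (ψ i t) ≤ ‖ψ i s + ψ i (t - s) - ψ i t‖ + ‖ψ i (t - s)‖ := by
    rw [dist_eq_norm]
    simpa [add_sub_right_comm] using norm_sub_le (ψ i s + ψ i (t - s) - ψ i t) (ψ i (t - s))
  linarith

/-- Equicontinuous exponents have limits along every ultrafilter. -/
lemma exists_isLevyExponent_tendsto (U : Ultrafilter ι) :
    ∃ Ψ, IsLevyExponent Ψ ∧ ∀ t, Tendsto (fun i => ψ i t) U (𝓝 (Ψ t)) := by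
  have hlim : ∀ t, ∃ z, Tendsto (fun i => ψ i t) U (𝓝 z) := by
    intro t
    obtain ⟨M, hM⟩ := exists_norm_le_of_equicontinuousAt hψ he t
    obtain ⟨z, -, hz⟩ := (isCompact_closedBall (0 : ℂ) M).ultrafilter_le_nhds
      (U.map fun i => ψ i t) (le_principal_iff.2 (by
        refine Filter.mem_map.2 (Filter.univ_mem' fun i => ?_)
        simpa using hM i))
    exact ⟨z, hz⟩
  choose Ψ hΨ using hlim
  have hcont : Continuous Ψ := continuous_iff_continuousAt.2 fun s =>
    (tendsto_pi_nhds.2 hΨ : Tendsto ψ U (𝓝 Ψ)).continuousAt_of_equicontinuousAt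
      (equicontinuous_of_isLevyExponent hψ he s)
  refine ⟨Ψ, ⟨hcont, ?_, fun u hu => ?_, fun s h c hc => ?_⟩, hΨ⟩
  · have := hΨ 0
    simp only [(hψ _).zero] at this
    exact (tendsto_nhds_unique this tendsto_const_nhds)
  · refine IsCharFun.of_tendsto (l := (U : Filter ι)) (fun i => (hψ i).charFun u hu) ?_ fun t => ?_
    · have hce : Continuous fun z : ℂ => Complex.exp (-(u * z)) := by fun_prop
      rw [Metric.equicontinuousAt_iff] at he ⊢
      intro ε hε
      obtain ⟨η, hη, h1⟩ := Metric.continuousAt_iff.1 (hce.continuousAt (x := 0)) ε hε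
      obtain ⟨δ, hδ, hd⟩ := he η hη
      refine ⟨δ, hδ, fun t ht i => ?_⟩
      have h2 := hd t ht i
      rw [(hψ i).zero, dist_comm] at h2
      rw [(hψ i).zero, dist_comm]
      exact h1 h2
    · have hce : Continuous fun z : ℂ => Complex.exp (-(u * z)) := by fun_prop
      exact (hce.tendsto _).comp (hΨ t)
  · refine le_of_tendsto_of_tendsto (((hΨ s).add (hΨ h)).sub (hΨ (s + h))).norm
      ((((Complex.continuous_re.tendsto _).comp (hΨ s)).const_mul c).add
      (((Complex.continuous_re.tendsto _).comp (hΨ h)).div_const c)) ?_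
    exact Eventually.of_forall fun i => (hψ i).norm_add_le s h c hc

omit hψ he in
lemma Equicontinuous.tendsto_comp_of_tendsto {κ : Type*} {l : Filter κ} {N : κ → ι} {x : κ → ℝ}
    {s : ℝ} {z : ℂ} (hE : Equicontinuous ψ) (hx : Tendsto x l (𝓝 s))
    (h : Tendsto (fun k => ψ (N k) s) l (𝓝 z)) : Tendsto (fun k => ψ (N k) (x k)) l (𝓝 z) := by
  have h1 : Tendsto (fun k => dist (ψ (N k) s) (ψ (N k) (x k))) l (𝓝 0) := by
    rw [Metric.tendsto_nhds]
    intro ε hε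
    obtain ⟨δ, hδ, hd⟩ := Metric.equicontinuousAt_iff.1 (hE s) ε hε
    filter_upwards [Metric.tendsto_nhds.1 hx δ hδ] with k hk
    simpa using hd _ hk (N k)
  exact (tendsto_iff_of_dist h1).1 h

end Families

/-! ### Normalized exponents and convergence of types. -/

/-- The exponent of the `n`-th normalized compound Poisson law. -/
noncomputable def normExponent (g : ℝ → ℂ) (a b : ℕ → ℝ) (n : ℕ) (t : ℝ) : ℂ :=
  (n : ℂ) * (1 - g (t / a n) * Complex.exp (-(Complex.I * (t : ℂ) * (b n : ℂ))))

lemma IsCharFun.normalize {g : ℝ → ℂ} (hg : IsCharFun g) (a b : ℝ) :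
    IsCharFun (fun t => g (t / a) * Complex.exp (-(Complex.I * (t : ℂ) * (b : ℂ)))) := by
  convert (hg.comp_mul a⁻¹).mul (exp_linear (-b)) using 4
  · ring
  · push_cast; ring

lemma IsCharFun.isLevyExponent_normExponent {g : ℝ → ℂ} (hg : IsCharFun g) (a b : ℕ → ℝ) (n : ℕ) :
    IsLevyExponent (normExponent g a b n) := by
  simpa [normExponent, Function.comp_def] using! (hg.normalize (a n) (b n)).isLevyExponent (r := n) (by positivity)

/-- If `N (1 - exp (i d t))` converges for all `t` to a continuous function, this is linear. -/
lemma exists_linear_of_tendsto {κ : Type*} {l : Filter κ} [l.NeBot] {N : κ → ℕ} {d : κ → ℝ}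
    (hN : Tendsto N l atTop) {q : ℝ → ℂ} (hq : Continuous q)
    (h : ∀ t : ℝ, Tendsto (fun k => (N k : ℂ) * (1 - Complex.exp (-(Complex.I * t * d k)))) l
      (𝓝 (q t))) : ∃ β : ℝ, ∀ t : ℝ, q t = Complex.I * β * t := by
  have hinv : Tendsto (fun k => ((N k : ℂ))⁻¹) l (𝓝 0) :=
    (tendsto_inv_atTop_nhds_zero_nat (𝕜 := ℂ)).comp hN
  have hadd : ∀ s t, q (s + t) = q s + q t := by
    intro s t
    -- From 1 - zw = (1 - z) + (1 - w) - (1 - z)(1 - w): after multiplication by N the product term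
    -- is of order 1/N.
    have h1 := ((h s).add (h t)).sub (((h s).mul (h t)).mul hinv)
    rw [mul_zero, sub_zero] at h1
    refine tendsto_nhds_unique (h (s + t)) (h1.congr' ?_)
    filter_upwards [hN.eventually_ge_atTop 1] with k hk
    have hk : (N k : ℂ) ≠ 0 := by exact_mod_cast (by omega : N k ≠ 0)
    have : Complex.exp (-(Complex.I * ((s + t : ℝ) : ℂ) * d k)) =
        Complex.exp (-(Complex.I * s * d k)) * Complex.exp (-(Complex.I * t * d k)) := by
      rw [← Complex.exp_add]; congr 1; push_cast; ring
    rw [this]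
    field_simp
    ring
  have hconj : ∀ t, q (-t) = (starRingEnd ℂ) (q t) := by
    intro t
    refine tendsto_nhds_unique (h (-t)) (((Complex.continuous_conj.tendsto _).comp (h t)).congr ?_)
    intro k
    simp only [Function.comp_apply, map_mul, map_sub, map_one, map_natCast, ← Complex.exp_conj]
    simp
  have hq0 : q 0 = 0 := by simpa using hadd 0 0
  have hre : ∀ t, (q t).re = 0 := by
    intro t
    have h1 := hadd t (-t)
    rw [add_neg_cancel, hq0, hconj] at h1
    have := congrArg Complex.re h1
    simp at this
    linarith
  refine ⟨(q 1).im, fun t => ?_⟩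
  rw [eq_mul_of_continuous_of_add hq hadd t]
  apply Complex.ext <;> simp [hre]
  ring

/-- Convergence of types for the normalized exponents. -/
lemma exists_affine_of_tendsto {g : ℝ → ℂ} {a b : ℕ → ℝ} (ha : ∀ n, 0 < a n)
    (hE : Equicontinuous (normExponent g a b)) {κ : Type*} {l : Filter κ} [l.NeBot]
    {N M : κ → ℕ} (hN : Tendsto N l atTop) {m c : ℝ} (hm : m ≠ 0)
    (hMN : Tendsto (fun k => (M k / N k : ℝ)) l (𝓝 m))
    (hc : Tendsto (fun k => a (N k) / a (M k)) l (𝓝 c)) {Ψ Ψ' : ℝ → ℂ} (hΨc : Continuous Ψ)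
    (hΨc' : Continuous Ψ')
    (hΨ : ∀ t, Tendsto (fun k => normExponent g a b (N k) t) l (𝓝 (Ψ t)))
    (hΨ' : ∀ t, Tendsto (fun k => normExponent g a b (M k) t) l (𝓝 (Ψ' t))) :
    ∃ d : ℝ, ∀ t : ℝ, Ψ' t = m * (Ψ (c * t) + Complex.I * d * t) := by
  have hinv : Tendsto (fun k => ((N k : ℂ))⁻¹) l (𝓝 0) :=
    (tendsto_inv_atTop_nhds_zero_nat (𝕜 := ℂ)).comp hN
  -- The rescaled argument puts the same value g(t / a_M) into both exponents. It cancels, up to the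
  -- factor 1 - A/N → 1, leaving only the relative shift `d`.
  set A : κ → ℝ → ℂ := fun k t => normExponent g a b (N k) (a (N k) / a (M k) * t)
  have hA : ∀ t, Tendsto (fun k => A k t) l (𝓝 (Ψ (c * t))) := fun t =>
    hE.tendsto_comp_of_tendsto (hc.mul_const t) (hΨ (c * t))
  have hmC : (m : ℂ) ≠ 0 := by exact_mod_cast hm
  have hMN' : Tendsto (fun k => (M k / N k : ℂ)) l (𝓝 m) := by
    have := (Complex.continuous_ofReal.tendsto m).comp hMN
    simpa [Function.comp_def] using this
  set d : κ → ℝ := fun k => b (M k) - a (N k) / a (M k) * b (N k)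
  have hG : ∀ t, Tendsto (fun k => 1 - A k t * (N k : ℂ)⁻¹) l (𝓝 1) := by
    intro t
    simpa using tendsto_const_nhds.sub ((hA t).mul hinv)
  have hlin : ∀ t : ℝ, Tendsto (fun k => (N k : ℂ) * (1 - Complex.exp (-(Complex.I * t * d k)))) l
      (𝓝 (Ψ' t / m - Ψ (c * t))) := by
    intro t
    have h1 := (((hΨ' t).div hMN' hmC).sub (hA t)).div (hG t) one_ne_zero
    rw [div_one] at h1
    refine h1.congr' ?_
    filter_upwards [hN.eventually_ge_atTop 1, (hG t).eventually_ne one_ne_zero,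
      hMN'.eventually_ne hmC] with k hk hk1 hk2
    have hk : (N k : ℂ) ≠ 0 := by exact_mod_cast (by omega : N k ≠ 0)
    have hMk : (M k : ℂ) ≠ 0 := fun h => hk2 (by rw [h, zero_div])
    have haN := (ha (N k)).ne'
    have haM := (ha (M k)).ne'
    simp only [Pi.div_apply]
    rw [div_eq_iff hk1]
    have e1 : 1 - A k t * (N k : ℂ)⁻¹ = g (t / a (M k)) *
        Complex.exp (-(Complex.I * ((a (N k) / a (M k) * t : ℝ) : ℂ) * b (N k))) := by
      simp only [A, normExponent]
      rw [show a (N k) / a (M k) * t / a (N k) = t / a (M k) by field_simp]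
      field_simp
      ring
    have e2 : normExponent g a b (M k) t = M k * (1 - (1 - A k t * (N k : ℂ)⁻¹) *
        Complex.exp (-(Complex.I * t * d k))) := by
      rw [e1, mul_assoc (g _), ← Complex.exp_add, normExponent]
      congr 4
      simp only [d]
      push_cast
      ring
    rw [e2]
    field_simp
    ring
  obtain ⟨β, hβ⟩ := exists_linear_of_tendsto hN (by fun_prop) hlin
  refine ⟨β, fun t => ?_⟩
  rw [← hβ t]
  field_simp
  ring

/-! ### Convolution semigroups on the half-line. -/

/-- A continuous positive solution of the exponential Cauchy equation on the half-line. -/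
lemma exists_eq_exp_neg_mul {A : ℝ → ℝ} (hA : Continuous A) (hpos : ∀ u, 0 ≤ u → 0 < A u)
    (hmul : ∀ u w, 0 ≤ u → 0 ≤ w → A (u + w) = A u * A w) :
    ∃ κ : ℝ, ∀ u, 0 ≤ u → A u = Real.exp (-(κ * u)) := by
  let F : ℝ → ℝ := fun u => Real.log (A (max u 0))
  have hF : Continuous F := Continuous.log (by fun_prop) fun u => (hpos _ (le_max_right _ _)).ne'
  have hFadd : ∀ u w, 0 ≤ u → 0 ≤ w → F (u + w) = F u + F w := by
    intro u w hu hw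
    simp only [F, max_eq_left hu, max_eq_left hw, max_eq_left (add_nonneg hu hw)]
    rw [hmul u w hu hw, Real.log_mul (hpos u hu).ne' (hpos w hw).ne']
  have hF0 : F 0 = 0 := by simpa using hFadd 0 0 le_rfl le_rfl
  have hFmax : ∀ u, F (max u 0) = F u := fun u => by simp [F]
  -- F(u) - F(-u) is the odd extension of log A, additive on the whole line.
  have hq := eq_mul_of_continuous_of_add (q := fun u => F u - F (-u)) (by fun_prop) (fun s t => by
    have e : max (s + t) 0 + (max (-s) 0 + max (-t) 0)
        = max (-(s + t)) 0 + (max s 0 + max t 0) := by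
      have hm : ∀ x : ℝ, max x 0 - max (-x) 0 = x := fun x => by
        rcases le_total 0 x with h | h
        · rw [max_eq_left h, max_eq_right (by linarith)]; ring
        · rw [max_eq_right h, max_eq_left (by linarith)]; ring
      linarith [hm s, hm t, hm (s + t)]
    have hn : ∀ x : ℝ, 0 ≤ max x 0 := fun x => le_max_right _ _
    have e2 := congrArg F e
    rw [hFadd _ _ (hn _) (add_nonneg (hn _) (hn _)), hFadd _ _ (hn _) (hn _),
      hFadd _ _ (hn _) (add_nonneg (hn _) (hn _)), hFadd _ _ (hn _) (hn _)] at e2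
    simp only [hFmax] at e2
    linarith)
  refine ⟨-(F 1 - F (-1)), fun u hu => ?_⟩
  have h1 := hq u
  have h2 : F (-u) = 0 := by
    rw [← hFmax, max_eq_right (by linarith), hF0]
  simp only [h2, sub_zero, smul_eq_mul] at h1
  rw [neg_mul, neg_neg, mul_comm, ← h1]
  simp only [F, max_eq_left hu]
  rw [Real.exp_log (hpos u hu)]

/-- `ν` is a weakly continuous convolution semigroup with characteristic exponent `ψ`. -/
structure IsLevySemigroup (ψ : ℝ → ℂ) (ν : ℝ → ProbabilityMeasure ℝ) : Prop where
  continuous : Continuous ν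
  charFun_eq : ∀ u : ℝ, 0 ≤ u → ∀ t : ℝ, charFun (ν u : Measure ℝ) t = Complex.exp (-(u * ψ t))

namespace IsLevySemigroup

variable {ψ : ℝ → ℂ} {ν : ℝ → ProbabilityMeasure ℝ} (hν : IsLevySemigroup ψ ν)
include hν

lemma conv_eq {u w : ℝ} (hu : 0 ≤ u) (hw : 0 ≤ w) :
    (ν (u + w) : Measure ℝ) = (ν u : Measure ℝ) ∗ (ν w : Measure ℝ) := by
  refine Measure.ext_of_charFun (funext fun t => ?_)
  rw [charFun_conv, hν.charFun_eq _ (add_nonneg hu hw), hν.charFun_eq _ hu, hν.charFun_eq _ hw,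
    ← Complex.exp_add]
  congr 1; push_cast; ring

lemma map_affine_eq {ψ' : ℝ → ℂ} {ν' : ℝ → ProbabilityMeasure ℝ} (hν' : IsLevySemigroup ψ' ν')
    {c d : ℝ} (hrel : ∀ t : ℝ, ψ' t = ψ (c * t) - Complex.I * d * t) {u : ℝ} (hu : 0 ≤ u) :
    (ν' u : Measure ℝ) = (ν u : Measure ℝ).map (fun x => c * x + d * u) := by
  have hm : (ν u : Measure ℝ).map (fun x => c * x + d * u) =
      ((ν u : Measure ℝ).map (c * ·)).map (· + d * u) := by
    rw [Measure.map_map (by fun_prop) (by fun_prop)]; rfl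
  have : IsProbabilityMeasure ((ν u : Measure ℝ).map (c * ·)) :=
    Measure.isProbabilityMeasure_map (by fun_prop)
  have : IsProbabilityMeasure (((ν u : Measure ℝ).map (c * ·)).map (· + d * u)) :=
    Measure.isProbabilityMeasure_map (by fun_prop)
  rw [hm]
  refine Measure.ext_of_charFun (funext fun t => ?_)
  rw [charFun_map_add_const, charFun_map_mul, hν.charFun_eq _ hu, hν'.charFun_eq _ hu,
    ← Complex.exp_add, hrel]
  congr 1
  simp
  ring

lemma continuous_integral {f : ℝ → ℝ} (hf : Continuous f) (hC : ∃ C, ∀ x, ‖f x‖ ≤ C) :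
    Continuous fun u => ∫ x, f x ∂(ν u : Measure ℝ) := by
  obtain ⟨C, hC⟩ := hC
  let F := BoundedContinuousFunction.ofNormedAddCommGroup f hf C hC
  refine continuous_iff_continuousAt.2 fun u => ?_
  exact (ProbabilityMeasure.tendsto_iff_forall_integral_tendsto.1 (hν.continuous.tendsto u)) F

lemma measure_Iio_add {u w : ℝ} (hu : 0 ≤ u) (hw : 0 ≤ w)
    (h1 : (ν u : Measure ℝ) (Set.Iio 0) = 0) (h2 : (ν w : Measure ℝ) (Set.Iio 0) = 0) :
    (ν (u + w) : Measure ℝ) (Set.Iio 0) = 0 := by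
  rw [hν.conv_eq hu hw, Measure.conv, Measure.map_apply (by fun_prop) measurableSet_Iio]
  refine measure_mono_null (t := Set.Iio (0 : ℝ) ×ˢ Set.univ ∪ Set.univ ×ˢ Set.Iio (0 : ℝ)) ?_ ?_
  · rintro ⟨x, y⟩ hxy
    simp only [Set.mem_preimage, Set.mem_Iio] at hxy
    by_contra hcon
    simp at hcon
    linarith
  · refine measure_union_null ?_ ?_ <;> rw [Measure.prod_prod] <;> simp [h1, h2]

/-- Two independent halves that are both negative have a negative sum, so P(X_{u/2} < 0)² ≤ P(X_u <
0). -/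
lemma measure_Iio_half {u : ℝ} (hu : 0 ≤ u) (h : (ν u : Measure ℝ) (Set.Iio 0) = 0) :
    (ν (u / 2) : Measure ℝ) (Set.Iio 0) = 0 := by
  have hu2 : 0 ≤ u / 2 := by positivity
  have h1 := hν.conv_eq hu2 hu2
  rw [add_halves] at h1
  rw [h1, Measure.conv, Measure.map_apply (by fun_prop) measurableSet_Iio] at h
  have h2 := measure_mono_null (s := Set.Iio (0 : ℝ) ×ˢ Set.Iio (0 : ℝ)) (fun p hp => by
    simp only [Set.mem_prod, Set.mem_Iio, Set.mem_preimage] at hp ⊢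
    linarith) h
  rw [Measure.prod_prod] at h2
  simpa using h2

/-- If one law of the semigroup lives on the half-line, then all of them do. -/
lemma measure_Iio_eq_zero {u₀ : ℝ} (hu₀ : 0 < u₀) (h : (ν u₀ : Measure ℝ) (Set.Iio 0) = 0)
    {u : ℝ} (hu : 0 ≤ u) : (ν u : Measure ℝ) (Set.Iio 0) = 0 := by
  have hhalf : ∀ k : ℕ, (ν (u₀ / 2 ^ k) : Measure ℝ) (Set.Iio 0) = 0 := by
    intro k
    induction k with
    | zero => simpa using h
    | succ k ih =>
      have := hν.measure_Iio_half (by positivity) ih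
      rwa [div_div, ← pow_succ] at this
  have hz : (ν 0 : Measure ℝ) (Set.Iio 0) = 0 := by
    have : (ν 0 : Measure ℝ) = Measure.dirac 0 := Measure.ext_of_charFun (funext fun t => by
      rw [hν.charFun_eq 0 le_rfl, charFun_dirac]; simp)
    rw [this]; simp
  have hmul : ∀ k n : ℕ, (ν (n * (u₀ / 2 ^ k)) : Measure ℝ) (Set.Iio 0) = 0 := by
    intro k n
    induction n with
    | zero => simpa using hz
    | succ n ih =>
      rw [Nat.cast_succ, add_one_mul]
      exact hν.measure_Iio_add (by positivity) (by positivity) ih (hhalf k)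
  -- Dyadic multiples of `u₀` approximate `u`, and the mass of the open set (-∞, 0) is lower
  -- semicontinuous.
  have hlim : Tendsto (fun k : ℕ => (⌊u / u₀ * 2 ^ k⌋₊ : ℝ) * (u₀ / 2 ^ k)) atTop (𝓝 u) := by
    have h1 := (tendsto_nat_floor_mul_div_atTop (R := ℝ) (a := u / u₀) (by positivity)).comp
      (tendsto_pow_atTop_atTop_of_one_lt (one_lt_two (α := ℝ)))
    have h2 := h1.mul_const u₀
    rw [div_mul_cancel₀ _ hu₀.ne'] at h2
    refine h2.congr fun k => ?_
    simp only [Function.comp_apply]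
    ring
  have := ProbabilityMeasure.le_liminf_measure_open_of_tendsto
    ((hν.continuous.tendsto u).comp hlim) (isOpen_Iio (a := (0 : ℝ)))
  simpa [Function.comp_def, hmul] using this

/-- The Laplace transforms of a semigroup on the half-line are exponentials. -/
lemma exists_laplace_exponent (hpos : ∀ u, 0 ≤ u → (ν u : Measure ℝ) (Set.Iio 0) = 0)
    {l : ℝ} (hl : 0 ≤ l) :
    ∃ κ : ℝ, 0 ≤ κ ∧
      ∀ u, 0 ≤ u → ∫ x, Real.exp (-(l * x)) ∂(ν u : Measure ℝ) = Real.exp (-(κ * u)) := by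
  -- Truncation at 0 makes the integrand bounded on ℝ without changing the integrals.
  have hmax : ∀ u, 0 ≤ u → ∫ x, Real.exp (-(l * max x 0)) ∂(ν u : Measure ℝ) =
      ∫ x, Real.exp (-(l * x)) ∂(ν u : Measure ℝ) := fun u hu => by
    refine integral_congr_ae ?_
    filter_upwards [ae_nonneg_of_measure_Iio (hpos u hu)] with x hx
    rw [max_eq_left hx]
  have hb : ∀ x : ℝ, ‖Real.exp (-(l * max x 0))‖ ≤ 1 := fun x => by
    rw [Real.norm_eq_abs, Real.abs_exp, Real.exp_le_one_iff]
    have := mul_nonneg hl (le_max_right x 0)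
    linarith
  have hint : ∀ u, 0 ≤ u → Integrable (fun x => Real.exp (-(l * x))) (ν u : Measure ℝ) :=
    fun u hu => integrable_rexp_neg_mul (hpos u hu) hl
  obtain ⟨κ, hκ⟩ := exists_eq_exp_neg_mul
    (A := fun u => ∫ x, Real.exp (-(l * max x 0)) ∂(ν u : Measure ℝ))
    (hν.continuous_integral (by fun_prop) ⟨1, hb⟩) (fun u hu => by
      rw [hmax u hu]
      exact integral_exp_pos (hint u hu)) (fun u w hu hw => by
      rw [hmax u hu, hmax w hw, hmax _ (add_nonneg hu hw), hν.conv_eq hu hw, integral_conv]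
      · simp only [mul_add, neg_add, Real.exp_add, integral_const_mul, integral_mul_const]
      · rw [← hν.conv_eq hu hw]
        exact hint _ (add_nonneg hu hw))
  refine ⟨κ, ?_, fun u hu => by rw [← hmax u hu, hκ u hu]⟩
  have h1 : Real.exp (-(κ * 1)) ≤ 1 := by
    rw [← hκ 1 zero_le_one]
    calc _ ≤ ∫ x, (1 : ℝ) ∂(ν 1 : Measure ℝ) := by
          refine integral_mono_of_nonneg (ae_of_all _ fun x => by positivity)
            (integrable_const _) (ae_of_all _ fun x => (le_abs_self _).trans (hb x))
      _ = 1 := by simp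
  rw [Real.exp_le_one_iff] at h1
  linarith

end IsLevySemigroup

/-! ### Rigidity of subordinated laws under affine maps. -/

section Uniqueness

variable {ρ : Measure ℝ} [IsProbabilityMeasure ρ] (h0 : ρ (Set.Iio 0) = 0)
  (h1 : ρ (Set.Ioi 0) ≠ 0) {ψ ψ' : ℝ → ℂ} {ν ν' : ℝ → ProbabilityMeasure ℝ}
  (hν : IsLevySemigroup ψ ν) (hν' : IsLevySemigroup ψ' ν')
  {c d : ℝ} (hc0 : 0 < c) (hc1 : c ≤ 1) (hd : 0 ≤ d)
  (hrel : ∀ t : ℝ, ψ' t = ψ (c * t) - Complex.I * d * t)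
  (he : ∀ t, laplace ρ (ψ t) = laplace ρ (ψ' t))
include h0 h1 hν hν' hc0 hc1 hd hrel he

/-- The test function exp(min(x, 0)) is strictly increasing on negatives, and x ↦ cx + du never
lowers its value. Equal mixtures force equality at some u₀ > 0 and almost every x; a negative x
would then be fixed, whence c = 1 and d = 0. -/
lemma exists_measure_Iio_eq_zero (hcd : ¬ (c = 1 ∧ d = 0)) :
    ∃ u₀, 0 < u₀ ∧ (ν u₀ : Measure ℝ) (Set.Iio 0) = 0 := by
  let f : ℝ → ℝ := fun x => Real.exp (min x 0)
  have hf : Continuous f := by fun_prop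
  have hC : ∀ x, ‖f x‖ ≤ 1 := fun x => by simp [f]
  have hfi : ∀ (g : ℝ → ℝ), Continuous g → ∀ u, Integrable (fun x => f (g x)) (ν u : Measure ℝ) :=
    fun g hg u => (integrable_const (1 : ℝ)).mono' (by fun_prop) (ae_of_all _ fun x => hC _)
  have hle : ∀ u, 0 ≤ u → ∀ x, f x ≤ f (c * x + d * u) := by
    intro u hu x
    refine Real.exp_le_exp.2 (le_min ?_ (min_le_right _ _))
    have := mul_nonneg hd hu
    rcases le_total 0 x with hx | hx
    · exact (min_le_right _ _).trans (by positivity)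
    · exact (min_le_left _ _).trans (by nlinarith)
  have hint := integral_eq_of_laplace_eq h0 hν.continuous hν'.continuous hν.charFun_eq
    hν'.charFun_eq he hf ⟨1, hC⟩
  have hν'e : ∀ u, 0 ≤ u → ∫ x, f x ∂(ν' u : Measure ℝ) =
      ∫ x, f (c * x + d * u) ∂(ν u : Measure ℝ) := fun u hu => by
    rw [hν.map_affine_eq hν' hrel hu, integral_map (by fun_prop) (by fun_prop)]
  have hb : ∀ {ν : ℝ → ProbabilityMeasure ℝ} (u : ℝ), ‖∫ x, f x ∂(ν u : Measure ℝ)‖ ≤ 1 :=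
    fun u => (norm_integral_le_of_norm_le_const (ae_of_all _ hC)).trans (by simp)
  have hi1 : Integrable (fun u => ∫ x, f x ∂(ν u : Measure ℝ)) ρ :=
    (integrable_const (1 : ℝ)).mono'
      (hν.continuous_integral hf ⟨1, hC⟩).aestronglyMeasurable (ae_of_all _ hb)
  have hi2 : Integrable (fun u => ∫ x, f x ∂(ν' u : Measure ℝ)) ρ :=
    (integrable_const (1 : ℝ)).mono'
      (hν'.continuous_integral hf ⟨1, hC⟩).aestronglyMeasurable (ae_of_all _ hb)
  have hae := (integral_eq_iff_of_ae_le hi1 hi2 (by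
    filter_upwards [ae_nonneg_of_measure_Iio h0] with u hu
    rw [hν'e u hu]
    exact integral_mono (hfi _ continuous_id u) (hfi _ (by fun_prop) u) (hle u hu))).1 hint
  obtain ⟨u₀, hu₀, hue⟩ : ∃ u₀, 0 < u₀ ∧
      ∫ x, f x ∂(ν u₀ : Measure ℝ) = ∫ x, f x ∂(ν' u₀ : Measure ℝ) := by
    by_contra! hcon
    refine h1 (measure_mono_null (fun u hu => ?_) (ae_iff.1 hae))
    exact hcon u hu
  refine ⟨u₀, hu₀, ?_⟩
  rw [hν'e u₀ hu₀.le] at hue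
  have h2 := (integral_eq_iff_of_ae_le (hfi _ continuous_id u₀) (hfi _ (by fun_prop) u₀)
    (ae_of_all _ (hle u₀ hu₀.le))).1 hue
  refine measure_mono_null (fun x hx => ?_) (ae_iff.1 h2)
  simp only [Set.mem_Iio] at hx
  simp only [Set.mem_ofPred_eq, f, Real.exp_eq_exp, id_eq, min_eq_left hx.le]
  intro hcon
  have h3 : x = c * x + d * u₀ := by
    rcases min_choice (c * x + d * u₀) 0 with h | h <;> rw [h] at hcon
    · exact hcon
    · exact absurd hcon hx.ne
  have h4 : d * u₀ = 0 ∧ (1 - c) * x = 0 := by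
    have e1 := mul_nonneg hd hu₀.le
    have e2 : (1 - c) * x ≤ 0 := mul_nonpos_of_nonneg_of_nonpos (by linarith) hx.le
    constructor <;> linarith
  apply hcd
  constructor
  · rcases mul_eq_zero.1 h4.2 with h | h
    · linarith
    · exact absurd h hx.ne
  · exact (mul_eq_zero.1 h4.1).resolve_right hu₀.ne'

-- Testing the mixtures with e^{-lx} gives φ(κ(l)) = φ(κ(lc) + ld), and φ is injective on [0, ∞).
omit hc1 in
lemma laplace_exponent_eq (hpos : ∀ u, 0 ≤ u → (ν u : Measure ℝ) (Set.Iio 0) = 0)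
    {κ : ℝ → ℝ} (hκ0 : ∀ l, 0 ≤ l → 0 ≤ κ l) (hκ : ∀ l, 0 ≤ l → ∀ u, 0 ≤ u →
      ∫ x, Real.exp (-(l * x)) ∂(ν u : Measure ℝ) = Real.exp (-(κ l * u))) {l : ℝ} (hl : 0 ≤ l) :
    κ l = κ (l * c) + l * d := by
  have hlc : 0 ≤ l * c := by positivity
  have hld : 0 ≤ l * d := by positivity
  refine eq_of_integral_exp_neg_mul_eq h0 h1 (hκ0 l hl) (add_nonneg (hκ0 _ hlc) hld) ?_
  have hb : ∀ x : ℝ, ‖Real.exp (-(l * max x 0))‖ ≤ 1 := fun x => by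
    rw [Real.norm_eq_abs, Real.abs_exp, Real.exp_le_one_iff]
    have := mul_nonneg hl (le_max_right x 0)
    linarith
  have hint := integral_eq_of_laplace_eq h0 hν.continuous hν'.continuous hν.charFun_eq
    hν'.charFun_eq he (f := fun x => Real.exp (-(l * max x 0))) (by fun_prop) ⟨1, hb⟩
  calc _ = ∫ u, ∫ x, Real.exp (-(l * max x 0)) ∂(ν u : Measure ℝ) ∂ρ := by
        refine integral_congr_ae ?_
        filter_upwards [ae_nonneg_of_measure_Iio h0] with u hu
        rw [← hκ l hl u hu]
        refine integral_congr_ae ?_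
        filter_upwards [ae_nonneg_of_measure_Iio (hpos u hu)] with x hx
        rw [max_eq_left hx]
    _ = _ := hint
    _ = _ := by
        refine integral_congr_ae ?_
        filter_upwards [ae_nonneg_of_measure_Iio h0] with u hu
        rw [hν.map_affine_eq hν' hrel hu, integral_map (by fun_prop) (by fun_prop), add_mul,
          neg_add, Real.exp_add, ← hκ _ hlc u hu, ← integral_mul_const]
        refine integral_congr_ae ?_
        filter_upwards [ae_nonneg_of_measure_Iio (hpos u hu)] with x hx
        rw [max_eq_left (by positivity), ← Real.exp_add]
        congr 1; ring

/-- A nondegenerate subordinated law determines the type normalization of the exponent. -/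
lemma affine_trivial_of_laplace_eq : (c = 1 ∧ d = 0) ∨ ∀ t, (ψ t).re = 0 := by
  by_cases hcd : c = 1 ∧ d = 0
  · exact Or.inl hcd
  right
  obtain ⟨u₀, hu₀, hz⟩ := exists_measure_Iio_eq_zero h0 h1 hν hν' hc0 hc1 hd hrel he hcd
  have hpos : ∀ u, 0 ≤ u → (ν u : Measure ℝ) (Set.Iio 0) = 0 :=
    fun u hu => hν.measure_Iio_eq_zero hu₀ hz hu
  have hex : ∀ l : ℝ, ∃ κ : ℝ, 0 ≤ l → 0 ≤ κ ∧ ∀ u, 0 ≤ u →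
      ∫ x, Real.exp (-(l * x)) ∂(ν u : Measure ℝ) = Real.exp (-(κ * u)) := by
    intro l
    by_cases hl : 0 ≤ l
    · obtain ⟨κ, hκ⟩ := hν.exists_laplace_exponent hpos hl
      exact ⟨κ, fun _ => hκ⟩
    · exact ⟨0, fun h => absurd h hl⟩
  choose κ hκ using hex
  have hrec : ∀ l, 0 ≤ l → κ l = κ (l * c) + l * d := fun l hl =>
    laplace_exponent_eq h0 h1 hν hν' hc0 hd hrel he hpos (fun l hl => (hκ l hl).1)
      (fun l hl => (hκ l hl).2) hl
  have hc1 : c < 1 := by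
    refine lt_of_le_of_ne hc1 fun hc => hcd ⟨hc, ?_⟩
    have := hrec 1 zero_le_one
    rw [hc] at this
    simpa using this
  -- `v` is the fixed point of x ↦ cx + d. Then κ(l) - lv is invariant under l ↦ lc, and it tends to
  -- 0 along the iterates.
  set v := d / (1 - c)
  have hv : d = v * (1 - c) := (div_mul_cancel₀ _ (by linarith)).symm
  have hone : ∀ l, 0 ≤ l → ∫ x, Real.exp (-(l * x)) ∂(ν 1 : Measure ℝ) = Real.exp (-κ l) :=
    fun l hl => by rw [(hκ l hl).2 1 zero_le_one, mul_one]
  have hlin : ∀ l, 0 ≤ l → κ l = l * v := by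
    intro l hl
    have hiter : ∀ n : ℕ, κ l - l * v = κ (l * c ^ n) - l * c ^ n * v := by
      intro n
      induction n with
      | zero => simp
      | succ n ih =>
        rw [ih, hrec (l * c ^ n) (by positivity), hv, pow_succ]
        ring_nf
    have hx : Tendsto (fun n : ℕ => l * c ^ n) atTop (𝓝 0) := by
      simpa using (tendsto_pow_atTop_nhds_zero_of_lt_one hc0.le hc1).const_mul l
    have hκlim : Tendsto (fun n : ℕ => Real.exp (-κ (l * c ^ n))) atTop (𝓝 1) := by
      have : ∀ n : ℕ, Real.exp (-κ (l * c ^ n)) =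
          ∫ x, Real.exp (-(l * c ^ n * x)) ∂(ν 1 : Measure ℝ) := fun n =>
        (hone _ (by positivity)).symm
      simp only [this]
      rw [show 𝓝 (1 : ℝ) = 𝓝 (∫ x : ℝ, (1 : ℝ) ∂(ν 1 : Measure ℝ)) by simp]
      refine tendsto_integral_of_dominated_convergence (fun _ => (1 : ℝ)) (fun n => by fun_prop)
        (integrable_const _) (fun n => ?_) (ae_of_all _ fun x => ?_)
      · filter_upwards [ae_nonneg_of_measure_Iio (hpos 1 zero_le_one)] with x hx
        rw [Real.norm_eq_abs, Real.abs_exp, Real.exp_le_one_iff]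
        have : 0 ≤ l * c ^ n * x := by positivity
        linarith
      · have := (Real.continuous_exp.tendsto _).comp ((hx.mul_const x).neg)
        simpa [Function.comp_def] using this
    have h3 : Tendsto (fun n : ℕ => Real.exp (-(κ (l * c ^ n) - l * c ^ n * v))) atTop (𝓝 1) := by
      have := hκlim.mul ((Real.continuous_exp.tendsto _).comp (hx.mul_const v))
      simp only [zero_mul, Real.exp_zero, mul_one] at this
      refine this.congr fun n => ?_
      simp only [Function.comp_apply]
      rw [← Real.exp_add]
      congr 1; ring
    have h4 := tendsto_nhds_unique (h3.congr fun n => by rw [← hiter n]) tendsto_const_nhds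
    rw [eq_comm, Real.exp_eq_one_iff] at h4
    linarith
  have hp1 := hpos 1 zero_le_one
  have hi := fun l (hl : 0 ≤ l) => integrable_rexp_neg_mul (ρ := (ν 1 : Measure ℝ)) hp1 (x := l) hl
  -- κ(1) = v and κ(2) = 2v make the second moment of e^{-X} about e^{-v} vanish, so X = v almost
  -- surely.
  have hsq : ∫ x, (Real.exp (-x) - Real.exp (-v)) ^ 2 ∂(ν 1 : Measure ℝ) = 0 := by
    have e : ∀ x : ℝ, (Real.exp (-x) - Real.exp (-v)) ^ 2 =
        Real.exp (-(2 * x)) - 2 * Real.exp (-v) * Real.exp (-(1 * x)) + Real.exp (-v) ^ 2 := by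
      intro x
      rw [show -(2 * x) = -x + -x by ring, Real.exp_add, one_mul]
      ring
    simp only [e]
    rw [integral_add (by exact (hi 2 zero_le_two).sub ((hi 1 zero_le_one).const_mul _))
      (integrable_const _), integral_sub (hi 2 zero_le_two) ((hi 1 zero_le_one).const_mul _),
      integral_const_mul, hone 2 zero_le_two, hone 1 zero_le_one, hlin 2 zero_le_two,
      hlin 1 zero_le_one, show -(2 * v) = -v + -v by ring, Real.exp_add]
    simp
    ring
  have hisq : Integrable (fun x => (Real.exp (-x) - Real.exp (-v)) ^ 2) (ν 1 : Measure ℝ) := by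
    refine ((integrable_const ((1 + Real.exp (-v)) ^ 2))).mono' (by fun_prop) ?_
    filter_upwards [ae_nonneg_of_measure_Iio hp1] with x hx
    rw [Real.norm_eq_abs, abs_of_nonneg (sq_nonneg _)]
    have e1 : Real.exp (-x) ≤ 1 := Real.exp_le_one_iff.2 (by linarith)
    have e2 := Real.exp_pos (-x)
    have e3 := Real.exp_pos (-v)
    exact sq_le_sq' (by linarith) (by linarith)
  have hae := (integral_eq_zero_iff_of_nonneg (fun x => sq_nonneg _) hisq).1 hsq
  intro t
  have hcf : charFun (ν 1 : Measure ℝ) t = Complex.exp (t * v * Complex.I) := by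
    rw [charFun_apply_real]
    have : ∫ x : ℝ, Complex.exp (t * x * Complex.I) ∂(ν 1 : Measure ℝ) =
        ∫ x : ℝ, Complex.exp (t * v * Complex.I) ∂(ν 1 : Measure ℝ) := by
      refine integral_congr_ae ?_
      filter_upwards [hae] with x hx
      have h5 : Real.exp (-x) = Real.exp (-v) := by
        simpa [sub_eq_zero] using hx
      rw [Real.exp_eq_exp, neg_inj] at h5
      rw [h5]
    rw [this]
    simp
  rw [hν.charFun_eq 1 zero_le_one] at hcf
  have := congrArg norm hcf
  rw [Complex.norm_exp, Complex.norm_exp, Real.exp_eq_exp] at this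
  simpa using this

end Uniqueness

/-! ### Self-attraction of stable laws; sequences with vanishing increments. -/

/-- Continuous logarithms of the same function with the same initial value coincide. -/
lemma eq_of_exp_eq {p q : ℝ → ℂ} (hp : Continuous p) (hq : Continuous q) (h0 : p 0 = q 0)
    (h : ∀ t, Complex.exp (p t) = Complex.exp (q t)) : p = q := by
  have hD : Continuous fun t => p t - q t := hp.sub hq
  have hz : ∀ t, ‖p t - q t‖ < 1 → p t - q t = 0 := by
    intro t ht
    have : Complex.exp (p t - q t) = 1 := by
      rw [Complex.exp_sub, h, div_self (Complex.exp_ne_zero _)]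
    obtain ⟨k, hk⟩ := Complex.exp_eq_one_iff.1 this
    by_cases hk0 : k = 0
    · simpa [hk0] using hk
    · have h1 : ‖p t - q t‖ = |(k : ℝ)| * (2 * Real.pi) := by
        rw [hk]; simp [abs_of_pos Real.pi_pos]
      have h2 : (1 : ℝ) ≤ |(k : ℝ)| := by exact_mod_cast Int.one_le_abs hk0
      nlinarith [Real.pi_gt_three]
  have hclopen : IsClopen {t | p t - q t = 0} := by
    refine ⟨isClosed_eq hD continuous_const, ?_⟩
    have : {t | p t - q t = 0} = {t | ‖p t - q t‖ < 1} := by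
      ext t
      exact ⟨fun ht => by
        simp only [Set.mem_ofPred_eq] at ht ⊢
        simp [ht], hz t⟩
    rw [this]
    exact isOpen_lt hD.norm continuous_const
  have huniv := hclopen.eq_univ ⟨0, by simp [h0]⟩
  funext t
  have : t ∈ {t | p t - q t = 0} := huniv ▸ Set.mem_univ t
  exact sub_eq_zero.1 this

lemma tendsto_mul_one_sub_exp_div (z : ℂ) :
    Tendsto (fun n : ℕ => (n : ℂ) * (1 - Complex.exp (-(z / n)))) atTop (𝓝 z) := by
  have h1 : Tendsto (fun n : ℕ => ‖z‖ ^ 2 / n) atTop (𝓝 0) :=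
    tendsto_const_div_atTop_nhds_zero_nat _
  refine tendsto_iff_norm_sub_tendsto_zero.2 (squeeze_zero' (Eventually.of_forall fun _ =>
    norm_nonneg _) ?_ h1)
  filter_upwards [eventually_ge_atTop (⌈‖z‖⌉₊ + 1)] with n hn
  have hn1 : ‖z‖ ≤ n := (Nat.le_ceil _).trans (by exact_mod_cast (by omega : ⌈‖z‖⌉₊ ≤ n))
  have hn0 : (0 : ℝ) < n := by exact_mod_cast (by omega : 0 < n)
  have hnC : (n : ℂ) ≠ 0 := by exact_mod_cast hn0.ne'
  have hnorm : ‖-(z / n)‖ = ‖z‖ / n := by simp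
  have h2 := Complex.norm_exp_sub_one_sub_id_le (x := -(z / n))
    (by rw [hnorm]; exact div_le_one_of_le₀ hn1 hn0.le)
  calc ‖(n : ℂ) * (1 - Complex.exp (-(z / n))) - z‖
      = ‖(n : ℂ) * -(Complex.exp (-(z / n)) - 1 - -(z / n))‖ := by
        congr 1; field_simp; ring
    _ = n * ‖Complex.exp (-(z / n)) - 1 - -(z / n)‖ := by
        rw [norm_mul, norm_neg, Complex.norm_natCast]
    _ ≤ n * (‖z‖ / n) ^ 2 := by rw [← hnorm]; gcongr
    _ = ‖z‖ ^ 2 / n := by field_simp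

lemma tendsto_laplace {ρ : Measure ℝ} [IsProbabilityMeasure ρ] (h0 : ρ (Set.Iio 0) = 0)
    {κ : Type*} {l : Filter κ} {z : κ → ℂ} {w : ℂ} (hz : ∀ k, 0 ≤ (z k).re) (hw : 0 ≤ w.re)
    (h : Tendsto z l (𝓝 w)) : Tendsto (fun k => laplace ρ (z k)) l (𝓝 (laplace ρ w)) :=
  (continuousOn_laplace h0 w hw).tendsto.comp
    (tendsto_nhdsWithin_iff.2 ⟨h, Eventually.of_forall hz⟩)

/-- The stable characteristic function belongs to the domain of attraction of `φ (-log ω)`. -/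
lemma exists_tendsto_normExponent {ψ : ℝ → ℂ} (hψ : Continuous ψ) (hψ0 : ψ 0 = 0)
    (hs : IsStableCharFun (fun t => Complex.exp (-ψ t))) :
    ∃ a b : ℕ → ℝ, (∀ n, 0 < a n) ∧ ∀ t : ℝ,
      Tendsto (fun n => normExponent (fun t => Complex.exp (-ψ t)) a b n t) atTop (𝓝 (ψ t)) := by
  have hch : ∀ n : ℕ, ∃ c d : ℝ, 0 < c ∧ (1 ≤ n → ∀ t : ℝ, Complex.exp (-ψ t) ^ n =
      Complex.exp (Complex.I * d * t) * Complex.exp (-ψ (c * t))) := by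
    intro n
    by_cases hn : 1 ≤ n
    · obtain ⟨c, hc, d, h⟩ := hs.2 n hn
      exact ⟨c, d, hc, fun _ => h⟩
    · exact ⟨1, 0, one_pos, fun h => absurd h hn⟩
  choose c d hc hcd using hch
  -- This shift makes the normalized function exactly exp(-ψ/n).
  refine ⟨c, fun n => d n / (n * c n), hc, fun t => ?_⟩
  refine (tendsto_mul_one_sub_exp_div (ψ t)).congr' ?_
  filter_upwards [eventually_ge_atTop 1] with n hn
  have hnC : (n : ℂ) ≠ 0 := by exact_mod_cast (by omega : n ≠ 0)
  have hcC : (c n : ℂ) ≠ 0 := by exact_mod_cast (hc n).ne'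
  -- The stability relation only identifies exponentials; continuity of the logarithms removes the
  -- 2πi ambiguity.
  have hlog : (fun s : ℝ => -((n : ℂ) * (ψ (s / c n) + Complex.I * s * (d n / (n * c n) : ℝ)))) =
      fun s => -ψ s := by
    refine eq_of_exp_eq (by fun_prop) (by fun_prop) (by simp [hψ0]) fun s => ?_
    have h1 := hcd n hn (s / c n)
    rw [mul_div_cancel₀ _ (hc n).ne'] at h1
    have h2 : -((n : ℂ) * (ψ (s / c n) + Complex.I * s * (d n / (n * c n) : ℝ))) =
        n * -ψ (s / c n) + -(Complex.I * d n * (s / c n : ℝ)) := by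
      push_cast; field_simp; ring
    rw [h2, Complex.exp_add, Complex.exp_nat_mul, h1, mul_right_comm, ← Complex.exp_add,
      add_neg_cancel, Complex.exp_zero, one_mul]
  have h3 := congrFun hlog t
  simp only [neg_inj] at h3
  rw [normExponent, ← Complex.exp_add, ← h3, mul_div_cancel_left₀ _ hnC, neg_add]

lemma isStableCharFun_linear (β : ℝ) :
    IsStableCharFun (fun t => Complex.exp (-(Complex.I * β * t))) := by
  refine ⟨by simpa using IsCharFun.exp_linear (-β), fun n hn => ⟨n, by exact_mod_cast hn, 0,
    fun t => ?_⟩⟩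
  rw [← Complex.exp_nat_mul, ← Complex.exp_add]
  congr 1
  push_cast
  ring

/-- A sequence with vanishing increments converges to each of its cluster points that is isolated
in the limiting level set. -/
lemma tendsto_of_isolated {z : ℕ → ℂ} {x w : ℂ} {F : ℂ → ℂ} {r : ℝ} (hr : 0 < r)
    (hF : ContinuousOn F (Metric.closedBall x r))
    (hne : ∀ y ∈ Metric.closedBall x r, y ≠ x → F y ≠ w)
    (hFz : Tendsto (fun n => F (z n)) atTop (𝓝 w))
    (hinc : Tendsto (fun n => z (n + 1) - z n) atTop (𝓝 0))
    (hcl : MapClusterPt x atTop z) : Tendsto z atTop (𝓝 x) := by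
  rw [Metric.tendsto_atTop]
  intro ε hε
  set e := min ε r
  have he : 0 < e := lt_min hε hr
  -- |F - w| is bounded below on this annulus, and steps shorter than e/2 cannot jump over it.
  have hcomp : IsCompact (Metric.closedBall x e ∩ (Metric.ball x (e / 2))ᶜ) :=
    (isCompact_closedBall _ _).inter_right Metric.isOpen_ball.isClosed_compl
  have hsub : Metric.closedBall x e ∩ (Metric.ball x (e / 2))ᶜ ⊆ Metric.closedBall x r :=
    Set.inter_subset_left.trans (Metric.closedBall_subset_closedBall (min_le_right _ _))
  obtain ⟨y, hy, hmin⟩ := hcomp.exists_isMinOn (f := fun y => dist w (F y))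
    ⟨x + e, by simp [abs_of_pos he], by simp [abs_of_pos he, he.le]⟩
    (Continuous.comp_continuousOn (continuous_const.dist continuous_id) (hF.mono hsub))
  have hm : 0 < dist w (F y) := by
    refine dist_pos.2 (hne y (hsub hy) fun h => hy.2 ?_).symm
    rw [h]
    exact Metric.mem_ball_self (by positivity)
  obtain ⟨N₁, hN₁⟩ := Metric.tendsto_atTop.1 hFz _ hm
  obtain ⟨N₂, hN₂⟩ := Metric.tendsto_atTop.1 hinc (e / 2) (by positivity)
  have hfr := (mapClusterPt_iff_frequently.1 hcl) _ (Metric.ball_mem_nhds x (half_pos he))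
  obtain ⟨n₀, hn₀, hz₀⟩ := (Filter.frequently_atTop.1 hfr) (max N₁ N₂)
  refine ⟨n₀, fun n hn => ?_⟩
  have key : dist (z n) x < e / 2 := by
    induction n, hn using Nat.le_induction with
    | base => exact hz₀
    | succ n hn ih =>
      have h1 := hN₂ n ((le_max_right _ _).trans (hn₀.trans hn))
      rw [dist_zero_right] at h1
      have h2 : dist (z (n + 1)) x ≤ e := by
        have := dist_triangle (z (n + 1)) (z n) x
        rw [dist_eq_norm (z (n + 1)) (z n)] at this
        linarith
      by_contra hcon
      have h3 := hmin (show z (n + 1) ∈ _ from ⟨h2, hcon⟩)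
      have h4 := hN₁ (n + 1) ((le_max_left _ _).trans (hn₀.trans (hn.trans n.le_succ)))
      rw [dist_comm] at h4
      exact absurd h4 (not_lt.2 h3)
  exact key.trans_le ((half_le_self he.le).trans (min_le_left _ _))

/-! ### Uniqueness of the exponent within its type. -/

section Uniqueness

variable {ρ : Measure ℝ} [IsProbabilityMeasure ρ] (h0 : ρ (Set.Iio 0) = 0)
  (h1 : ρ (Set.Ioi 0) ≠ 0)
include h0 h1

/-- A drift `d` corresponds to the exponent -idt; reflecting t ↦ -t makes the drift nonnegative. -/
lemma IsLevyExponent.eq_of_affine_of_le_one {ψ ψ' : ℝ → ℂ} (hψ : IsLevyExponent ψ)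
    (hψ' : IsLevyExponent ψ') (hnd : ¬ ∃ β : ℝ, ∀ t : ℝ, ψ t = Complex.I * β * t) {c d : ℝ}
    (hc0 : 0 < c) (hc1 : c ≤ 1) (hrel : ∀ t : ℝ, ψ' t = ψ (c * t) + Complex.I * d * t)
    (he : ∀ t, laplace ρ (ψ t) = laplace ρ (ψ' t)) : ψ' = ψ := by
  have key : c = 1 ∧ d = 0 := by
    rcases le_total d 0 with hd | hd
    · obtain ⟨ν, hν, hνc⟩ := hψ.exists_semigroup
      obtain ⟨ν', hν', hνc'⟩ := hψ'.exists_semigroup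
      rcases affine_trivial_of_laplace_eq h0 h1 ⟨hν, hνc⟩ ⟨hν', hνc'⟩ hc0 hc1
        (neg_nonneg.2 hd) (fun t => by rw [hrel]; push_cast; ring) he with h | h
      · exact ⟨h.1, neg_eq_zero.1 h.2⟩
      · exact absurd (hψ.eq_linear_of_re_eq_zero h) hnd
    · obtain ⟨ν, hν, hνc⟩ := hψ.comp_neg.exists_semigroup
      obtain ⟨ν', hν', hνc'⟩ := hψ'.comp_neg.exists_semigroup
      rcases affine_trivial_of_laplace_eq h0 h1 ⟨hν, hνc⟩ ⟨hν', hνc'⟩ hc0 hc1 hd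
        (fun t => by rw [hrel, mul_neg]; push_cast; ring) (fun t => he (-t)) with h | h
      · exact h
      · exact absurd (hψ.eq_linear_of_re_eq_zero fun t => by simpa using h (-t)) hnd
  funext t
  rw [hrel, key.1, key.2]
  simp

lemma IsLevyExponent.eq_of_affine {ψ ψ' : ℝ → ℂ} (hψ : IsLevyExponent ψ)
    (hψ' : IsLevyExponent ψ') (hnd : ¬ ∃ β : ℝ, ∀ t : ℝ, ψ t = Complex.I * β * t)
    (hnd' : ¬ ∃ β : ℝ, ∀ t : ℝ, ψ' t = Complex.I * β * t) {c d : ℝ}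
    (hc0 : 0 < c) (hrel : ∀ t : ℝ, ψ' t = ψ (c * t) + Complex.I * d * t)
    (he : ∀ t, laplace ρ (ψ t) = laplace ρ (ψ' t)) : ψ' = ψ := by
  rcases le_total c 1 with hc1 | hc1
  · exact hψ.eq_of_affine_of_le_one h0 h1 hψ' hnd hc0 hc1 hrel he
  · refine (hψ'.eq_of_affine_of_le_one h0 h1 hψ hnd' (c := c⁻¹) (d := -(d / c)) (by positivity)
      (inv_le_one_of_one_le₀ hc1) (fun t => ?_) fun t => (he t).symm).symm
    rw [hrel, mul_inv_cancel_left₀ hc0.ne']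
    push_cast
    field_simp
    ring

end Uniqueness

/-! ### Convergence of the normalized exponents to a stable exponent. -/

section Attraction

variable {g : ℝ → ℂ} {a b : ℕ → ℝ} (hg : IsCharFun g) (ha : ∀ n, 0 < a n)
  (hE : Equicontinuous (normExponent g a b))
  (hnd : ∀ (U : Ultrafilter ℕ) (Ψ : ℝ → ℂ), (U : Filter ℕ) ≤ atTop →
    (∀ t, Tendsto (fun n => normExponent g a b n t) U (𝓝 (Ψ t))) →
    ¬ ∃ β : ℝ, ∀ t : ℝ, Ψ t = Complex.I * β * t)

lemma Ultrafilter.exists_tendsto_Icc {ι : Type*} (U : Ultrafilter ι) {x : ι → ℝ} {p q : ℝ}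
    (h : ∀ᶠ i in (U : Filter ι), x i ∈ Set.Icc p q) :
    ∃ c ∈ Set.Icc p q, Tendsto x U (𝓝 c) :=
  (isCompact_Icc (a := p) (b := q)).ultrafilter_le_nhds (U.map x) (le_principal_iff.2 h)

include ha hE hnd in
/-- Limits of exponents along comparable subsequences are of the same type. -/
lemma exists_affine_of_nondegenerate {M : ℕ → ℕ} (hM : Tendsto M atTop atTop) {m : ℝ} (hm : 0 < m)
    (hMm : Tendsto (fun n => (M n / n : ℝ)) atTop (𝓝 m)) {U : Ultrafilter ℕ}
    (hU : (U : Filter ℕ) ≤ atTop) {Ψ Ψ' : ℝ → ℂ} (hΨ : IsLevyExponent Ψ) (hΨ' : IsLevyExponent Ψ')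
    (h : ∀ t, Tendsto (fun n => normExponent g a b n t) U (𝓝 (Ψ t)))
    (h' : ∀ t, Tendsto (fun n => normExponent g a b (M n) t) U (𝓝 (Ψ' t))) :
    ∃ c d : ℝ, 0 < c ∧ ∀ t : ℝ, Ψ' t = m * (Ψ (c * t) + Complex.I * d * t) := by
  have hmC : (m : ℂ) ≠ 0 := by exact_mod_cast hm.ne'
  have hndU := hnd U Ψ hU h
  have hndM := hnd (U.map M) Ψ' (by exact (hM.mono_left hU)) h'
  have hUM : Tendsto M U atTop := hM.mono_left hU
  -- Either a_n / a_{M n} or its inverse lies in [0, 1] along `U`, so it has a limit; limit 0 would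
  -- make one of the two exponents linear.
  rcases Ultrafilter.em U (fun n => a n ≤ a (M n)) with hle | hle
  · obtain ⟨c, hc, hlim⟩ := U.exists_tendsto_Icc (x := fun n => a n / a (M n)) (p := 0) (q := 1) (by
      filter_upwards [hle] with n hn
      exact ⟨(div_pos (ha _) (ha _)).le, div_le_one_of_le₀ hn (ha _).le⟩)
    obtain ⟨d, hd⟩ := exists_affine_of_tendsto (N := fun n => n) (M := M) ha hE hU hm.ne'
      (hMm.mono_left hU) hlim hΨ.continuous hΨ'.continuous h h'
    refine ⟨c, d, lt_of_le_of_ne hc.1 fun hc0 => hndM ⟨m * d, fun t => ?_⟩, hd⟩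
    rw [hd, ← hc0, zero_mul, hΨ.zero]
    push_cast; ring
  · have hinv : Tendsto (fun n => ((n : ℕ) / M n : ℝ)) U (𝓝 m⁻¹) := by
      simpa using (hMm.mono_left hU).inv₀ hm.ne'
    obtain ⟨c, hc, hlim⟩ := U.exists_tendsto_Icc (x := fun n => a (M n) / a n) (p := 0) (q := 1) (by
      filter_upwards [hle] with n hn
      exact ⟨(div_pos (ha _) (ha _)).le, div_le_one_of_le₀ (not_le.1 hn).le (ha _).le⟩)
    obtain ⟨d, hd⟩ := exists_affine_of_tendsto (N := M) (M := fun n => n) ha hE hUM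
      (inv_ne_zero hm.ne') hinv hlim hΨ'.continuous hΨ.continuous h' h
    have hc0 : 0 < c := lt_of_le_of_ne hc.1 fun hc0 => hndU ⟨m⁻¹ * d, fun t => by
      rw [hd, ← hc0, zero_mul, hΨ'.zero]
      push_cast; ring⟩
    have hcC : (c : ℂ) ≠ 0 := by exact_mod_cast hc0.ne'
    refine ⟨c⁻¹, -(d / (c * m)), by positivity, fun t => ?_⟩
    rw [hd, mul_inv_cancel_left₀ hc0.ne']
    push_cast
    field_simp
    ring

variable {ρ : Measure ℝ} [IsProbabilityMeasure ρ] (h0 : ρ (Set.Iio 0) = 0)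
  (h1 : ρ (Set.Ioi 0) ≠ 0) {f : ℝ → ℂ}
  (hlim : ∀ t, Tendsto (fun n => laplace ρ (normExponent g a b n t)) atTop (𝓝 (f t)))

include hg h0 hlim in
lemma eq_laplace_of_tendsto {l : Filter ℕ} [l.NeBot] (hl : l ≤ atTop) {Ψ : ℝ → ℂ}
    (hΨ : IsLevyExponent Ψ)
    (h : ∀ t, Tendsto (fun n => normExponent g a b n t) l (𝓝 (Ψ t))) (t : ℝ) :
    f t = laplace ρ (Ψ t) :=
  tendsto_nhds_unique ((hlim t).mono_left hl)
    (tendsto_laplace h0 (fun n => (hg.isLevyExponent_normExponent a b n).re_nonneg t)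
      (hΨ.re_nonneg t) (h t))

include hg ha hE hnd h0 h1 hlim

/-- Limits along n and n + 1 have the same type and the same image `f` under φ, so rigidity
identifies them. -/
lemma tendsto_normExponent_succ_sub (t : ℝ) : Tendsto
    (fun n => normExponent g a b (n + 1) t - normExponent g a b n t) atTop (𝓝 0) := by
  rw [tendsto_iff_ultrafilter]
  intro U hU
  have hL := hg.isLevyExponent_normExponent a b
  have hsucc : Tendsto (fun n : ℕ => n + 1) atTop atTop := tendsto_add_atTop_nat 1
  obtain ⟨Ψ, hΨ, hΨt⟩ := exists_isLevyExponent_tendsto hL (hE 0) U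
  obtain ⟨Ψ', hΨ', hΨt'⟩ := exists_isLevyExponent_tendsto hL (hE 0) (U.map (fun n => n + 1))
  have hU' : (U.map (fun n : ℕ => n + 1) : Filter ℕ) ≤ atTop := hsucc.mono_left hU
  have hratio : Tendsto (fun n : ℕ => ((n + 1 : ℕ) / n : ℝ)) atTop (𝓝 1) := by
    simpa [add_comm] using tendsto_add_mul_div_add_mul_atTop_nhds (𝕜 := ℝ) 1 0 1 one_ne_zero
  obtain ⟨c, d, hc, hcd⟩ := exists_affine_of_nondegenerate ha hE hnd hsucc one_pos hratio hU
    hΨ hΨ' hΨt hΨt'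
  have heq := hΨ.eq_of_affine h0 h1 hΨ' (hnd U Ψ hU hΨt) (hnd _ Ψ' hU' hΨt') hc
    (fun t => by simpa using hcd t) fun t => by
      rw [← eq_laplace_of_tendsto hg h0 hlim hU hΨ hΨt,
        ← eq_laplace_of_tendsto hg h0 hlim hU' hΨ' hΨt']
  have h2 : Tendsto (fun n => normExponent g a b (n + 1) t) U (𝓝 (Ψ' t)) := hΨt' t
  rw [heq] at h2
  simpa using h2.sub (hΨt t)

/-- The normalized exponents converge. -/
lemma exists_tendsto_of_nondegenerate : ∃ Ψ, IsLevyExponent Ψ ∧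
    ∀ t, Tendsto (fun n => normExponent g a b n t) atTop (𝓝 (Ψ t)) := by
  have hL := hg.isLevyExponent_normExponent a b
  let U : Ultrafilter ℕ := Ultrafilter.of atTop
  have hU : (U : Filter ℕ) ≤ atTop := Ultrafilter.of_le atTop
  obtain ⟨Ψ, hΨ, hΨt⟩ := exists_isLevyExponent_tendsto hL (hE 0) U
  have hdense := hΨ.dense_re_pos (hnd U Ψ hU hΨt)
  have hA : ∀ t ∈ {t : ℝ | 0 < (Ψ t).re},
      Tendsto (fun n => normExponent g a b n t) atTop (𝓝 (Ψ t)) := by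
    intro t ht
    have hpos : ∀ᶠ y in 𝓝 (Ψ t), 0 < y.re :=
      (isOpen_lt continuous_const Complex.continuous_re).mem_nhds ht
    have hev : ∀ᶠ y in 𝓝 (Ψ t), 0 < y.re ∧ (y ≠ Ψ t → laplace ρ y ≠ f t) :=
      hpos.and
        (eventually_nhdsWithin_iff.1 (eventually_laplace_ne h0 h1 ht (f t)))
    obtain ⟨r, hr, hball⟩ := Metric.nhds_basis_closedBall.eventually_iff.1 hev
    exact tendsto_of_isolated hr
      ((continuousOn_laplace h0).mono fun y hy => (hball hy).1.le)
      (fun y hy => (hball hy).2) (hlim t)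
      (tendsto_normExponent_succ_sub hg ha hE hnd h0 h1 hlim t)
      (((hΨt t).mapClusterPt).mono hU)
  refine ⟨Ψ, hΨ, fun t => ?_⟩
  rw [tendsto_iff_ultrafilter]
  intro V hV
  -- Any other limit agrees with Ψ on the dense set where Re Ψ > 0.
  obtain ⟨Φ, hΦ, hΦt⟩ := exists_isLevyExponent_tendsto hL (hE 0) V
  have : Φ = Ψ := hΦ.continuous.ext_on hdense hΨ.continuous fun s hs =>
    tendsto_nhds_unique (hΦt s) ((hA s hs).mono_left hV)
  rw [← this]
  exact hΦt t

/-- The limit of the normalized exponents is the exponent of a stable law. -/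
lemma exists_stable_of_nondegenerate : ∃ Ψ, Continuous Ψ ∧ Ψ 0 = 0 ∧
    IsStableCharFun (fun t => Complex.exp (-Ψ t)) ∧ (∀ t, 0 ≤ (Ψ t).re) ∧
    ∀ t, f t = laplace ρ (Ψ t) := by
  obtain ⟨Ψ, hΨ, hΨt⟩ := exists_tendsto_of_nondegenerate hg ha hE hnd h0 h1 hlim
  refine ⟨Ψ, hΨ.continuous, hΨ.zero, ⟨by simpa using hΨ.charFun 1 zero_le_one, fun m hm => ?_⟩,
    hΨ.re_nonneg, eq_laplace_of_tendsto hg h0 hlim le_rfl hΨ hΨt⟩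
  have hm0 : (0 : ℝ) < m := by exact_mod_cast hm
  -- The limit along mn is again Ψ, so Ψ(t) = m(Ψ(ct) + idt), which is stability.
  have hM : Tendsto (fun n : ℕ => m * n) atTop atTop := tendsto_id.const_mul_atTop' hm
  have hratio : Tendsto (fun n : ℕ => ((m * n : ℕ) / n : ℝ)) atTop (𝓝 m) := by
    refine tendsto_const_nhds.congr' ?_
    filter_upwards [eventually_ge_atTop 1] with n hn
    have : (n : ℝ) ≠ 0 := by exact_mod_cast (by omega : n ≠ 0)
    push_cast
    rw [mul_div_cancel_right₀ _ this]
  let U : Ultrafilter ℕ := Ultrafilter.of atTop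
  have hU : (U : Filter ℕ) ≤ atTop := Ultrafilter.of_le atTop
  obtain ⟨c, d, hc, hcd⟩ := exists_affine_of_nondegenerate ha hE hnd hM hm0 hratio hU hΨ hΨ
    (fun t => (hΨt t).mono_left hU) (fun t => ((hΨt t).comp hM).mono_left hU)
  refine ⟨c⁻¹, by positivity, m * d / c, fun t => ?_⟩
  rw [← Complex.exp_nat_mul, ← Complex.exp_add, hcd (c⁻¹ * t), mul_inv_cancel_left₀ hc.ne']
  congr 1
  push_cast
  ring

end Attraction

/-! ### Conclusion. -/

lemma laplace_eq_one {ρ : Measure ℝ} [IsProbabilityMeasure ρ] (h0 : ρ (Set.Iio 0) = 0)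
    (h1 : ρ (Set.Ioi 0) = 0) (z : ℂ) : laplace ρ z = 1 := by
  have hae : ∀ᵐ u ∂ρ, u = 0 := by
    rw [ae_iff]
    refine measure_mono_null (fun u hu => ?_) (measure_union_null h0 h1)
    exact lt_or_gt_of_ne hu
  have : laplace ρ z = ∫ _ : ℝ, (1 : ℂ) ∂ρ := by
    refine integral_congr_ae ?_
    filter_upwards [hae] with u hu
    simp [hu]
  rw [this]
  simp

theorem theorem4p1 (φ : ℂ → ℂ) (hφ : IsLaplaceTransform φ) (f : ℝ → ℂ) (hf : IsCharFun f) :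
    (phiAttractionDomain φ f).Nonempty ↔ IsPhiStable φ f := by
  obtain ⟨ρ, hρ, h0, hφρ⟩ := hφ
  have hφl : ∀ z : ℂ, 0 ≤ z.re → φ z = laplace ρ z := hφρ
  constructor
  · rintro ⟨g, hg, a, b, ha, hlimφ⟩
    have hL := hg.isLevyExponent_normExponent a b
    have hlim : ∀ t, Tendsto (fun n => laplace ρ (normExponent g a b n t)) atTop (𝓝 (f t)) :=
      fun t => (hlimφ t).congr fun n => hφl _ ((hL n).re_nonneg t)
    have hlinear : ∀ β : ℝ, (∀ t : ℝ, f t = laplace ρ (Complex.I * β * t)) → IsPhiStable φ f := by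
      intro β hβ
      refine ⟨fun t => Complex.I * β * t, by fun_prop, by simp, isStableCharFun_linear β,
        fun t => ?_⟩
      rw [hβ, hφl _ (by simp)]
    -- If ρ = δ₀ then φ and f are identically 1, and ψ = 0 serves.
    by_cases h1 : ρ (Set.Ioi 0) = 0
    · refine hlinear 0 fun t => ?_
      have := hlim t
      simp only [laplace_eq_one h0 h1] at this
      rw [laplace_eq_one h0 h1]
      exact tendsto_nhds_unique this tendsto_const_nhds
    have hE : Equicontinuous (normExponent g a b) :=
      equicontinuous_of_isLevyExponent hL (equicontinuousAt_of_laplace h0 h1 hL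
        (IsCharFun.equicontinuousAt_of_tendsto (fun n => (hL n).isCharFun_laplace h0) hf hlim))
    by_cases hnd : ∀ (U : Ultrafilter ℕ) (Ψ : ℝ → ℂ), (U : Filter ℕ) ≤ atTop →
        (∀ t, Tendsto (fun n => normExponent g a b n t) U (𝓝 (Ψ t))) →
        ¬ ∃ β : ℝ, ∀ t : ℝ, Ψ t = Complex.I * β * t
    · obtain ⟨Ψ, hc, hz, hs, hre, hfΨ⟩ :=
        exists_stable_of_nondegenerate hg ha hE hnd h0 h1 hlim
      exact ⟨Ψ, hc, hz, hs, fun t => by rw [hfΨ, hφl _ (hre t)]⟩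
    -- One linear limit along a single ultrafilter suffices, since φ(ψ_n) already converges to `f`.
    · push Not at hnd
      obtain ⟨U, Ψ, hU, hΨ, β, hβ⟩ := hnd
      refine hlinear β fun t => tendsto_nhds_unique ((hlim t).mono_left hU) ?_
      rw [← hβ]
      exact tendsto_laplace h0 (fun n => (hL n).re_nonneg t) (by simp [hβ]) (hΨ t)
  · rintro ⟨ψ, hψ, hψ0, hs, hfψ⟩
    obtain ⟨a, b, ha, hlim⟩ := exists_tendsto_normExponent hψ hψ0 hs
    refine ⟨_, hs.1, a, b, ha, fun t => ?_⟩
    have hL := hs.1.isLevyExponent_normExponent a b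
    have hre : 0 ≤ (ψ t).re := by
      have := hs.1.norm_le_one t
      rw [Complex.norm_exp, Real.exp_le_one_iff] at this
      simpa using this
    rw [hfψ, hφl _ hre]
    exact (tendsto_laplace h0 (fun n => (hL n).re_nonneg t) hre (hlim t)).congr
      fun n => (hφl _ ((hL n).re_nonneg t)).symm
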